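/- **Theorem (Generalized $\varepsilon$-DRFC reformulation).** *Setting.* Let $\|\cdot\|$ be a norm on $\mathbb{R}^d$ with dual norm $\|w\|_*=\sup\{w^\top x:\|x\|\le 1\}$, let $\mathcal A=\{0,1\}$, $\mathcal Y=\{-1,1\}$, and let $(\hat x_i,\hat a_i,\hat y_i)\in\mathbb{R}^d\times\mathcal A\times\mathcal Y$, $i\in[N]$, be training samples such that each $\mathcal I_{ay}=\{i:\hat a_i=a,\hat y_i=y\}$ is nonempty. Put $\hat p_{ay}=|\mathcal I_{ay}|/N$ and $\hat{\mathbb P}_{ay}=|\mathcal I_{ay}|^{-1}\sum_{i\in\mathcal I_{ay}}\delta_{\hat x_i}$. Let $\rho_{ay}\ge 0$, $\delta_p\ge 0$, $\varepsilon>0$, $\eta\ge 0$. Let $\mathbb W_\infty(\mu,\nu)=\inf_\pi \operatorname{ess\,sup}_\pi\|x-x'\|$ over couplings $\pi$ of $\mu$ and $\nu$, and $$\Delta=\Big\{p\in\mathbb{R}_{++}^{\mathcal A\times\mathcal Y}:\ \textstyle\sum_{a,y}p_{ay}=1,\ \sum_{a,y}(p_{ay}-\hat p_{ay})^2/p_{ay}\le\delta_p\Big\}.$$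 Let $\mathbb B_g$ be the set of probability measures $\mathbb Q$ on $\mathbb{R}^d\times\mathcal A\times\mathcal Y$ with $\mathbb Q(S\times\{a\}\times\{y\})=p_{ay}\mathbb Q_{ay}(S)$ (for all measurable $S$ and all $a,y$) for some $p\in\Delta$ and probability measures $\mathbb Q_{ay}$ on $\mathbb{R}^d$ with $\mathbb W_\infty(\mathbb Q_{ay},\hat{\mathbb P}_{ay})\le\rho_{ay}$. With $\mathbb Q_{ay}$ the conditional law of $X$ given $A=a,Y=y$ under $\mathbb Q$, let $$\mathbb U_\varepsilon(w,b,\mathbb Q)=\max_{(a,a')\in\{(0,1),(1,0)\}}\big\{\mathbb Q_{a1}(w^\top X+b>-\varepsilon)-\mathbb Q_{a'1}(w^\top X+b\ge 0)\big\}.$$ *Problems.* The generalized $\varepsilon$-DRFC problem is $$(\mathrm P)\qquad \min_{w\in\mathbb{R}^d,\,b\in\mathbb{R}}\ f(w,b):=\sup_{\mathbb Q\in\mathbb B_g}\mathbb Q\big(Y(w^\top X+b)<\varepsilon\big)\quad\text{s.t.}\quad \sup_{\mathbb Q\in\mathbb B_g}\mathbb U_\varepsilon(w,b,\mathbb Q)\le\eta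 .$$ For $M\in\mathbb{R}$ let $(\mathrm P_M)$ be the mixed-binary program $$\begin{array}{cll} \min & \delta_p\zeta-\theta-2\hat p^\top r+2\zeta\,1^\top\hat p\\ \text{s.t.} & w\in\mathbb{R}^d,\ b\in\mathbb{R},\ \zeta\ge 0,\ \theta\in\mathbb{R},\ r,s\in\mathbb{R}^{\mathcal A\times\mathcal Y},\ t,\lambda^0,\lambda^1\in\{0,1\}^N,\\ & s_{ay}+\theta\le\zeta,\quad \sqrt{4r_{ay}^2+(s_{ay}+\theta)^2}\le 2\zeta-s_{ay}-\theta & \forall (a,y),\\ & |\mathcal I_{ay}|^{-1}\sum_{i\in\mathcal I_{ay}}t_i\le s_{ay} & \forall (a,y),\\ & -\hat y_i(w^\top\hat x_i+b)+\rho_{\hat a_i\hat y_i}\|w\|_*\le Mt_i-\varepsilon & \forall i\in[N],\\ & |\mathcal I_{a1}|^{-1}\sum_{i\in\mathcal I_{a1}}\lambda^a_i+|\mathcal I_{a'1}|^{-1}\sum_{i\in\mathcal I_{a'1}}\lambda^a_i-1\le\eta & \forall (a,a')\in\{(0,1),(1,0)\},\\ & w^\top\hat x_i+\rho_{a1}\|w\|_*+b+\varepsilon\le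 M\lambda^a_i\quad \forall i\in\mathcal I_{a1} & \forall (a,a')\in\{(0,1),(1,0)\},\\ & -w^\top\hat x_i+\rho_{a'1}\|w\|_*-b\le M\lambda^a_i\quad \forall i\in\mathcal I_{a'1} & \forall (a,a')\in\{(0,1),(1,0)\}. \end{array}$$ *Claim.* $(\mathrm P)$ and $(\mathrm P_M)$ are equivalent for large $M$, in the following sense. 1. For every $M$ and every feasible point of $(\mathrm P_M)$, its component $(w,b)$ is feasible in $(\mathrm P)$, and $f(w,b)$ is at most the objective value of the point. 2. For every $R$ there is $M_0$ such that for all $M\ge M_0$ and all $(w,b)$ whose coordinates are bounded by $R$ in absolute value: $(w,b)$ is feasible in $(\mathrm P)$ if and only if it extends to a feasible point of $(\mathrm P_M)$, and in that case $f(w,b)$ is the infimum of the objective of $(\mathrm P_M)$ over all such extensions; the infimum is attained if $\delta_p>0$. 3. $(\mathrm P)$ has an optimal solution, and there is $M_0$ such that for all $M\ge M_0$ the optimal values of $(\mathrm P)$ and $(\mathrm P_M)$ coincide, $(\mathrm P_M)$ attains its optimal value if $\delta_p>0$, and the component $(w,b)$ of every optimal solution of $(\mathrm P_M)$ is optimal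 in $(\mathrm P)$. 4. If $\delta_p>0$, then for every optimal $(w,b)$ of $(\mathrm P)$ there is $M_0$ such that for all $M\ge M_0$ it extends to an optimal solution of $(\mathrm P_M)$. 5. If the set $\{(w,\tau):\|w\|_*\le\tau\}$ is described by finitely many second-order cone constraints (e.g. if $\|\cdot\|$ is the Euclidean norm, the 1-norm or the $\infty$-norm), then for every $M$, $(\mathrm P_M)$ is a mixed-binary second-order cone program: its objective is linear, and its feasible set is given by finitely many constraints $\|F(z)\|_2\le \ell(z)$ with $F,\ell$ affine, together with restrictions of some of the variables to $\{0,1\}$. -/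

import Mathlib

open MeasureTheory Set
open scoped ENNReal

namespace DRFC

noncomputable section

/-- Sensitive attributes `{0, 1}`. -/
abbrev Attr := Fin 2

/-- Class labels `{-1, 1}`, realised as the units of `ℤ`. -/
abbrev Label := ℤˣ

/-- The number `-1` or `1` that a label stands for. -/
def sgn (y : Label) : ℝ := ((y : ℤ) : ℝ)

/-- Outcome space `ℝ^d × {0, 1} × {-1, 1}` of `(X, A, Y)`. -/
abbrev Outcome (d : ℕ) := (Fin d → ℝ) × Attr × Label

/-- The training samples `(x i, a i, y i)`, `i = 1, …, N`. -/
structure Samples (d N : ℕ) where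
  x : Fin N → Fin d → ℝ
  a : Fin N → Attr
  y : Fin N → Label

/-- The index set of the samples with attribute `a` and label `y`. -/
def Samples.group {d N : ℕ} (D : Samples d N) (a : Attr) (y : Label) : Finset (Fin N) :=
  Finset.univ.filter fun i => D.a i = a ∧ D.y i = y

/-- The empirical marginal of `(A, Y)`. -/
def Samples.phat {d N : ℕ} (D : Samples d N) (a : Attr) (y : Label) : ℝ :=
  ((D.group a y).card : ℝ) / (N : ℝ)

/-- The empirical conditional distribution of `X` given `(A, Y) = (a, y)`. -/
def Samples.empCond {d N : ℕ} (D : Samples d N) (a : Attr) (y : Label) :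
    Measure (Fin d → ℝ) :=
  ((D.group a y).card : ℝ≥0∞)⁻¹ • ∑ i ∈ D.group a y, Measure.dirac (D.x i)

/-- `π` has the marginals `μ` and `ν`. -/
def IsCoupling {X : Type*} [MeasurableSpace X] (π : Measure (X × X)) (μ ν : Measure X) : Prop :=
  π.map Prod.fst = μ ∧ π.map Prod.snd = ν

/-- The type-`∞` Wasserstein distance on `ℝ^d` for the ground metric `nrm (x - x')`. -/
def wassInf {d : ℕ} (nrm : Seminorm ℝ (Fin d → ℝ)) (μ ν : Measure (Fin d → ℝ)) : ℝ≥0∞ :=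
  ⨅ (π : Measure ((Fin d → ℝ) × (Fin d → ℝ))) (_ : IsCoupling π μ ν),
    essSup (fun z => ENNReal.ofReal (nrm (z.1 - z.2))) π

/-- The `∞`-Wasserstein ball around the empirical conditional distribution. -/
def condBall {d N : ℕ} (nrm : Seminorm ℝ (Fin d → ℝ)) (D : Samples d N)
    (ρ : Attr → Label → ℝ) (a : Attr) (y : Label) : Set (Measure (Fin d → ℝ)) :=
  {μ | IsProbabilityMeasure μ ∧ wassInf nrm μ (D.empCond a y) ≤ ENNReal.ofReal (ρ a y)}

/-- The `χ²`-divergence ball around the empirical marginal of `(A, Y)`. -/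
def chiBall {d N : ℕ} (D : Samples d N) (δ : ℝ) : Set (Attr → Label → ℝ) :=
  {p | (∀ a y, 0 < p a y) ∧ (∑ a, ∑ y, p a y = 1) ∧
    ∑ a, ∑ y, (p a y - D.phat a y) ^ 2 / p a y ≤ δ}

/-- The generalized ambiguity set of joint distributions of `(X, A, Y)`. -/
def ambiguitySet {d N : ℕ} (nrm : Seminorm ℝ (Fin d → ℝ)) (D : Samples d N)
    (ρ : Attr → Label → ℝ) (δ : ℝ) : Set (Measure (Outcome d)) :=
  {Q | IsProbabilityMeasure Q ∧
    ∃ (μ : Attr → Label → Measure (Fin d → ℝ)) (p : Attr → Label → ℝ),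
      (∀ (S : Set (Fin d → ℝ)), MeasurableSet S → ∀ a y,
        Q (S ×ˢ ({a} ×ˢ {y})) = ENNReal.ofReal (p a y) * μ a y S) ∧
      p ∈ chiBall D δ ∧
      ∀ a y, μ a y ∈ condBall nrm D ρ a y}

/-- The event `A = a, Y = y`. -/
def groupEvent {d : ℕ} (a : Attr) (y : Label) : Set (Outcome d) :=
  {z | z.2.1 = a ∧ z.2.2 = y}

/-- The probability of `X ∈ S` given `A = a`, `Y = y`. -/
def condProb {d : ℕ} (Q : Measure (Outcome d)) (a : Attr) (y : Label)
    (S : Set (Fin d → ℝ)) : ℝ :=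
  (ProbabilityTheory.cond Q (groupEvent a y)).real {z | z.1 ∈ S}

/-- The `ε`-unfairness measure. -/
def unfairness {d : ℕ} (ε : ℝ) (w : Fin d → ℝ) (b : ℝ) (Q : Measure (Outcome d)) : ℝ :=
  max
    (condProb Q 0 1 {x | w ⬝ᵥ x + b > -ε} - condProb Q 1 1 {x | w ⬝ᵥ x + b ≥ 0})
    (condProb Q 1 1 {x | w ⬝ᵥ x + b > -ε} - condProb Q 0 1 {x | w ⬝ᵥ x + b ≥ 0})

/-- Worst-case `ε`-misclassification probability, the objective of the robust problem. -/
def robustObj {d N : ℕ} (nrm : Seminorm ℝ (Fin d → ℝ)) (D : Samples d N)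
    (ρ : Attr → Label → ℝ) (δ ε : ℝ) (wb : (Fin d → ℝ) × ℝ) : ℝ :=
  sSup ((fun Q : Measure (Outcome d) => Q.real {z | sgn z.2.2 * (wb.1 ⬝ᵥ z.1 + wb.2) < ε}) ''
    ambiguitySet nrm D ρ δ)

/-- Feasible classifiers of the robust problem: worst-case `ε`-unfairness at most `η`. -/
def robustFeasible {d N : ℕ} (nrm : Seminorm ℝ (Fin d → ℝ)) (D : Samples d N)
    (ρ : Attr → Label → ℝ) (δ ε η : ℝ) : Set ((Fin d → ℝ) × ℝ) :=
  {wb | sSup (unfairness ε wb.1 wb.2 '' ambiguitySet nrm D ρ δ) ≤ η}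

/-- The dual norm on `ℝ^d`. -/
def dualNorm {d : ℕ} (nrm : Seminorm ℝ (Fin d → ℝ)) (w : Fin d → ℝ) : ℝ :=
  sSup ((fun x => w ⬝ᵥ x) '' {x | nrm x ≤ 1})

/-- The names of the scalar decision variables of the mixed-binary program. -/
inductive Var (d N : ℕ) : Type
  | w (j : Fin d)
  | b
  | zeta
  | theta
  | r (a : Attr) (y : Label)
  | s (a : Attr) (y : Label)
  | t (i : Fin N)
  | lam (a : Attr) (i : Fin N)

/-- The classifier contained in a point of the mixed-binary program. -/
def classifier {d N : ℕ} (z : Var d N → ℝ) : (Fin d → ℝ) × ℝ :=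
  (fun j => z (.w j), z .b)

/-- The objective of the mixed-binary program. -/
def mipObj {d N : ℕ} (D : Samples d N) (δ : ℝ) (z : Var d N → ℝ) : ℝ :=
  δ * z .zeta - z .theta - 2 * (∑ a, ∑ y, D.phat a y * z (.r a y))
    + 2 * z .zeta * ∑ a, ∑ y, D.phat a y

/-- The feasible set of the mixed-binary program with big-M parameter `M`. -/
def mipFeasible {d N : ℕ} (nrm : Seminorm ℝ (Fin d → ℝ)) (D : Samples d N)
    (ρ : Attr → Label → ℝ) (ε η M : ℝ) : Set (Var d N → ℝ) :=
  {z | 0 ≤ z .zeta ∧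
    (∀ i, z (.t i) = 0 ∨ z (.t i) = 1) ∧
    (∀ a i, z (.lam a i) = 0 ∨ z (.lam a i) = 1) ∧
    (∀ a y, z (.s a y) + z .theta ≤ z .zeta) ∧
    (∀ a y, Real.sqrt (4 * z (.r a y) ^ 2 + (z (.s a y) + z .theta) ^ 2)
      ≤ 2 * z .zeta - z (.s a y) - z .theta) ∧
    (∀ a y, 1 / ((D.group a y).card : ℝ) * ∑ i ∈ D.group a y, z (.t i) ≤ z (.s a y)) ∧
    (∀ i, -sgn (D.y i) * ((classifier z).1 ⬝ᵥ D.x i + (classifier z).2)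
      + ρ (D.a i) (D.y i) * dualNorm nrm (classifier z).1 ≤ M * z (.t i) - ε) ∧
    (∀ a a' : Attr, a ≠ a' →
      1 / ((D.group a 1).card : ℝ) * ∑ i ∈ D.group a 1, z (.lam a i)
        + 1 / ((D.group a' 1).card : ℝ) * ∑ i ∈ D.group a' 1, z (.lam a i) - 1 ≤ η ∧
      (∀ i ∈ D.group a 1, (classifier z).1 ⬝ᵥ D.x i
        + ρ a 1 * dualNorm nrm (classifier z).1 + (classifier z).2 + ε ≤ M * z (.lam a i)) ∧
      (∀ i ∈ D.group a' 1, -((classifier z).1 ⬝ᵥ D.x i)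
        + ρ a' 1 * dualNorm nrm (classifier z).1 - (classifier z).2 ≤ M * z (.lam a i)))}

/-- The points of the mixed-binary program that contain the classifier `wb`. -/
def mipFiber {d N : ℕ} (nrm : Seminorm ℝ (Fin d → ℝ)) (D : Samples d N)
    (ρ : Attr → Label → ℝ) (ε η M : ℝ) (wb : (Fin d → ℝ) × ℝ) : Set (Var d N → ℝ) :=
  {z | z ∈ mipFeasible nrm D ρ ε η M ∧ classifier z = wb}

/-- A single second-order cone constraint `‖F z‖₂ ≤ l z` with `F`, `l` affine. -/
def IsConeConstraint {V : Type*} [AddCommGroup V] [Module ℝ V] (S : Set V) : Prop :=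
  ∃ (m : ℕ) (F : V →ᵃ[ℝ] EuclideanSpace ℝ (Fin m)) (l : V →ᵃ[ℝ] ℝ), S = {z | ‖F z‖ ≤ l z}

/-- The solution set of finitely many second-order cone constraints. -/
def IsConeSystem {V : Type*} [AddCommGroup V] [Module ℝ V] (S : Set V) : Prop :=
  ∃ (k : ℕ) (C : Fin k → Set V), (∀ j, IsConeConstraint (C j)) ∧ S = ⋂ j, C j

/-- Minimizing `c` over `S` is a mixed-binary second-order cone program: `c` is linear, and `S` is
described by finitely many second-order cone constraints and binary restrictions on variables. -/
def IsMixedBinarySOCP {ι : Type*} (c : (ι → ℝ) → ℝ) (S : Set (ι → ℝ)) : Prop :=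
  Finite ι ∧ (∃ l : (ι → ℝ) →ₗ[ℝ] ℝ, ∀ z, c z = l z) ∧
    ∃ (T : Set (ι → ℝ)) (B : Set ι), IsConeSystem T ∧
      S = {z | z ∈ T ∧ ∀ i ∈ B, z i = 0 ∨ z i = 1}

end

end DRFC

/-!
The theorem rests on three facts.

*Worst cases are counts.* For an open halfspace `c ⬝ᵥ x + β < κ`, the largest probability over the
`∞`-Wasserstein ball of radius `ρ` around an empirical distribution is the fraction of the samples
with `c ⬝ᵥ x + β < κ + ρ * dualNorm nrm c`, the *movable* samples. The bound holds because every
coupling with displacements at most `ρ + γ` leaves the other samples in `κ - γ * dualNorm nrm c ≤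
c ⬝ᵥ x + β`, and these closed halfspaces decrease to the complement as `γ → 0`
(`real_halfspace_le_movableFrac`). It is attained by one translation of all samples
(`exists_condBall_real_halfspace_eq`). As the group weights and the conditional laws can be chosen
independently, the robust objective is the supremum of `∑ p * worstMis` over the `χ²`-ball
(`robustObj_le`, `le_robustObj`), and the fairness constraint bounds sums of two fractions of
movable samples (`mem_robustFeasible_iff`). In particular the robust objective takes finitely many
values, so that the robust problem has a solution (`exists_isMinOn_robustObj`).

*Duality over the `χ²`-ball.* The variables `ζ`, `θ`, `r` of the program are dual variables for
the supremum of `∑ p * s`. Weak duality holds term by term (`sum_mul_le_dual`). For `δ > 0` there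
is no gap, and the dual is attained; the optimality conditions reduce to one equation in one real
unknown, solved by the intermediate value theorem (`exists_primal_eq_dual`). For `δ = 0` the dual
value is in general only approached as `ζ → ∞` (`exists_dual_le_add`).

*Binary variables mark movable samples.* A binary variable equal to `0` certifies that its sample
is not movable, for any `M`; with weak duality this gives the bounds valid for all `M`
(`classifier_mem_robustFeasible`, `robustObj_le_mipObj`). Conversely, on a bounded set of
classifiers a large `M` makes the constraints of the variables equal to `1` void, and marking
exactly the movable samples yields feasible points (`canonicalPoint_mem_mipFiber`), which strong
duality makes optimal.

The cone representation follows since cone systems are stable under finite intersections and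
affine preimages, every constraint with a positive multiple of the dual norm being an affine
preimage of its epigraph.
-/

namespace DRFC

/-! ### The dual norm -/

section DualNorm

variable {d : ℕ} {nrm : Seminorm ℝ (Fin d → ℝ)}

theorem continuous_seminorm_pi (nrm : Seminorm ℝ (Fin d → ℝ)) : Continuous nrm :=
  continuousOn_univ.1 (nrm.convexOn.continuousOn isOpen_univ)

theorem dotProduct_continuous (c : Fin d → ℝ) : Continuous fun x : Fin d → ℝ => c ⬝ᵥ x := by
  unfold dotProduct; fun_prop

/-- A definite seminorm on `ℝ^d` dominates a positive multiple of the sup norm: its minimum on the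
compact unit sphere is positive. -/
theorem exists_norm_le_mul_seminorm (hnrm : ∀ x, nrm x = 0 → x = 0) :
    ∃ K : ℝ, 0 ≤ K ∧ ∀ x, ‖x‖ ≤ K * nrm x := by
  rcases (Metric.sphere (0 : Fin d → ℝ) 1).eq_empty_or_nonempty with he | hne
  · refine ⟨0, le_rfl, fun x => ?_⟩
    by_contra! h
    have hx : ‖x‖ ≠ 0 := by simpa using h.ne'
    have : (‖x‖⁻¹ • x) ∈ Metric.sphere (0 : Fin d → ℝ) 1 := by
      simp [norm_smul, inv_mul_cancel₀ hx]
    simp [he] at this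
  · obtain ⟨u, hu, hmin⟩ := (isCompact_sphere (0 : Fin d → ℝ) 1).exists_isMinOn hne
      (continuous_seminorm_pi nrm).continuousOn
    have hu0 : 0 < nrm u := by
      refine lt_of_le_of_ne (apply_nonneg _ _) fun h => ?_
      have := hnrm u h.symm
      simp [this] at hu
    refine ⟨(nrm u)⁻¹, by positivity, fun x => ?_⟩
    rw [inv_mul_eq_div, le_div_iff₀ hu0]
    rcases eq_or_ne x 0 with rfl | hx
    · simp
    have hx : ‖x‖ ≠ 0 := by simpa using hx
    have hm : (‖x‖⁻¹ • x) ∈ Metric.sphere (0 : Fin d → ℝ) 1 := by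
      simp [norm_smul, inv_mul_cancel₀ hx]
    have h := hmin hm
    simp only [mem_ofPred_eq, map_smul_eq_mul, norm_inv, norm_norm] at h
    rwa [inv_mul_eq_div, le_div_iff₀ (by positivity), mul_comm] at h

theorem isCompact_seminorm_le_one (hnrm : ∀ x, nrm x = 0 → x = 0) :
    IsCompact {x | nrm x ≤ 1} := by
  obtain ⟨K, hK, h⟩ := exists_norm_le_mul_seminorm hnrm
  refine Metric.isCompact_of_isClosed_isBounded
    (isClosed_le (continuous_seminorm_pi nrm) continuous_const) ?_
  refine (Metric.isBounded_closedBall (x := 0) (r := K)).subset fun x hx => ?_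
  simpa using (h x).trans (mul_le_of_le_one_right hK hx)

/-- The supremum defining the dual norm is attained. -/
theorem exists_dotProduct_eq_dualNorm (hnrm : ∀ x, nrm x = 0 → x = 0) (w : Fin d → ℝ) :
    ∃ u, nrm u ≤ 1 ∧ w ⬝ᵥ u = dualNorm nrm w := by
  have h := (isCompact_seminorm_le_one hnrm).image (dotProduct_continuous w)
  obtain ⟨u, hu, he⟩ := h.sSup_mem ⟨_, mem_image_of_mem _ (by simp : (0 : Fin d → ℝ) ∈ _)⟩
  exact ⟨u, hu, he⟩

theorem dotProduct_le_dualNorm (hnrm : ∀ x, nrm x = 0 → x = 0) (w : Fin d → ℝ) {x : Fin d → ℝ}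
    (hx : nrm x ≤ 1) : w ⬝ᵥ x ≤ dualNorm nrm w :=
  le_csSup ((isCompact_seminorm_le_one hnrm).image (dotProduct_continuous w)).bddAbove
    (mem_image_of_mem _ hx)

theorem dualNorm_nonneg (hnrm : ∀ x, nrm x = 0 → x = 0) (w : Fin d → ℝ) :
    0 ≤ dualNorm nrm w := by
  simpa using dotProduct_le_dualNorm hnrm w (x := 0) (by simp)

theorem dotProduct_le_mul_dualNorm (hnrm : ∀ x, nrm x = 0 → x = 0) (w x : Fin d → ℝ) {r : ℝ}
    (hx : nrm x ≤ r) : w ⬝ᵥ x ≤ r * dualNorm nrm w := by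
  rcases (apply_nonneg nrm x).eq_or_lt with h | h
  · rw [hnrm x h.symm]
    simpa using mul_nonneg ((apply_nonneg nrm x).trans hx) (dualNorm_nonneg hnrm w)
  · have h1 := dotProduct_le_dualNorm hnrm w (x := (nrm x)⁻¹ • x) (by
      rw [map_smul_eq_mul, norm_inv, Real.norm_of_nonneg h.le, inv_mul_cancel₀ h.ne'])
    rw [dotProduct_smul, smul_eq_mul, inv_mul_eq_div, div_le_iff₀ h, mul_comm] at h1
    exact h1.trans (mul_le_mul_of_nonneg_right hx (dualNorm_nonneg hnrm w))

theorem dualNorm_neg (nrm : Seminorm ℝ (Fin d → ℝ)) (w : Fin d → ℝ) :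
    dualNorm nrm (-w) = dualNorm nrm w := by
  unfold dualNorm
  congr 1
  ext t
  constructor <;> rintro ⟨x, hx, rfl⟩ <;> exact ⟨-x, by simpa using hx, by simp⟩

theorem abs_dotProduct_le (w x : Fin d → ℝ) {R : ℝ} (hw : ∀ j, |w j| ≤ R) :
    |w ⬝ᵥ x| ≤ d * (R * ‖x‖) := by
  have : |w ⬝ᵥ x| ≤ ∑ j : Fin d, R * ‖x‖ := by
    refine (Finset.abs_sum_le_sum_abs _ _).trans (Finset.sum_le_sum fun j _ => ?_)
    rw [abs_mul]
    exact mul_le_mul (hw j) (norm_le_pi_norm x j) (abs_nonneg _) ((abs_nonneg _).trans (hw j))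
  simpa using this

theorem exists_dualNorm_le (hnrm : ∀ x, nrm x = 0 → x = 0) (R : ℝ) :
    ∃ C : ℝ, ∀ w : Fin d → ℝ, (∀ j, |w j| ≤ R) → dualNorm nrm w ≤ C := by
  obtain ⟨K, hK, h⟩ := exists_norm_le_mul_seminorm hnrm
  refine ⟨d * (|R| * K), fun w hw => ?_⟩
  obtain ⟨u, hu, he⟩ := exists_dotProduct_eq_dualNorm hnrm w
  rw [← he]
  refine (le_abs_self _).trans
    ((abs_dotProduct_le w u fun j => (hw j).trans (le_abs_self R)).trans ?_)
  have : ‖u‖ ≤ K := (h u).trans (mul_le_of_le_one_right hK hu)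
  gcongr

end DualNorm

/-! ### Uniform distributions on finitely many points -/

section Empirical

variable {ι X : Type*} [MeasurableSpace X]

/-- The uniform distribution on the points `f i`, `i ∈ s`, counted with multiplicity. -/
noncomputable def empirical (s : Finset ι) (f : ι → X) : Measure X :=
  (s.card : ℝ≥0∞)⁻¹ • ∑ i ∈ s, Measure.dirac (f i)

theorem isProbabilityMeasure_empirical {s : Finset ι} (hs : s.Nonempty) (f : ι → X) :
    IsProbabilityMeasure (empirical s f) := by
  constructor
  have : (s.card : ℝ≥0∞) ≠ 0 := by simpa using hs.ne_empty
  simp [empirical, Measure.smul_apply, ENNReal.inv_mul_cancel this (ENNReal.natCast_ne_top _)]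

theorem empirical_real (s : Finset ι) (f : ι → X) {S : Set X} (hS : MeasurableSet S)
    [DecidablePred fun i => f i ∈ S] :
    (empirical s f).real S = ((s.filter fun i => f i ∈ S).card : ℝ) / s.card := by
  simp [empirical, measureReal_def, Measure.smul_apply, Measure.finsetSum_apply, hS,
    Set.indicator_apply, Finset.sum_boole, div_eq_inv_mul]

theorem map_empirical {Z : Type*} [MeasurableSpace Z] (s : Finset ι) (f : ι → X) {g : X → Z}
    (hg : Measurable g) : (empirical s f).map g = empirical s (g ∘ f) := by
  ext S hS
  rw [Measure.map_apply hg hS]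
  simp [empirical, hg hS, hS, Set.indicator]
  rfl

theorem ae_empirical (s : Finset ι) (f : ι → X) {p : X → Prop} (hp : MeasurableSet {x | p x})
    (h : ∀ i ∈ s, p (f i)) : ∀ᵐ x ∂empirical s f, p x :=
  Measure.ae_smul_measure (ae_finsetSum_measure_iff.2 fun i hi =>
    (ae_dirac_iff hp).2 (h i hi)) _

end Empirical

/-! ### Worst-case probabilities of halfspaces -/

section Halfspace

variable {d N : ℕ} {nrm : Seminorm ℝ (Fin d → ℝ)} {D : Samples d N} {ρ : Attr → Label → ℝ}

theorem measurableSet_halfspace_lt (c : Fin d → ℝ) (β κ : ℝ) :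
    MeasurableSet {x : Fin d → ℝ | c ⬝ᵥ x + β < κ} :=
  measurableSet_lt ((dotProduct_continuous c).measurable.add_const β) measurable_const

theorem measurableSet_halfspace_ge (c : Fin d → ℝ) (β κ : ℝ) :
    MeasurableSet {x : Fin d → ℝ | κ ≤ c ⬝ᵥ x + β} :=
  measurableSet_le measurable_const ((dotProduct_continuous c).measurable.add_const β)

open Classical in
/-- The samples of a group that can be moved into the open halfspace `c ⬝ᵥ x + β < κ` by a
displacement of length at most `ρ a y`. -/
noncomputable def movable (nrm : Seminorm ℝ (Fin d → ℝ)) (D : Samples d N) (ρ : Attr → Label → ℝ)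
    (a : Attr) (y : Label) (c : Fin d → ℝ) (β κ : ℝ) : Finset (Fin N) :=
  (D.group a y).filter fun i => c ⬝ᵥ D.x i + β < κ + ρ a y * dualNorm nrm c

/-- The fraction of the movable samples of a group: the worst-case probability of the halfspace
`c ⬝ᵥ x + β < κ` over the Wasserstein ball of the group. -/
noncomputable def movableFrac (nrm : Seminorm ℝ (Fin d → ℝ)) (D : Samples d N)
    (ρ : Attr → Label → ℝ) (a : Attr) (y : Label) (c : Fin d → ℝ) (β κ : ℝ) : ℝ :=
  ((movable nrm D ρ a y c β κ).card : ℝ) / (D.group a y).card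

theorem card_group_pos (hD : ∀ a y, (D.group a y).Nonempty) (a : Attr) (y : Label) :
    (0 : ℝ) < (D.group a y).card := by
  exact_mod_cast (hD a y).card_pos

theorem movableFrac_nonneg (a : Attr) (y : Label) (c : Fin d → ℝ) (β κ : ℝ) :
    0 ≤ movableFrac nrm D ρ a y c β κ := by
  unfold movableFrac; positivity

theorem movableFrac_le_one (a : Attr) (y : Label) (c : Fin d → ℝ) (β κ : ℝ) :
    movableFrac nrm D ρ a y c β κ ≤ 1 :=
  div_le_one_of_le₀ (by exact_mod_cast Finset.card_filter_le _ _) (by positivity)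

/-- Near-optimal couplings bound the probability of every slightly larger closed halfspace from
below. -/
theorem le_real_halfspace_of_wassInf_lt (hnrm : ∀ x, nrm x = 0 → x = 0) {a : Attr} {y : Label}
    {μ : Measure (Fin d → ℝ)} [IsProbabilityMeasure μ] {τ : ℝ}
    (hτ : wassInf nrm μ (D.empCond a y) < ENNReal.ofReal τ) (c : Fin d → ℝ) (β κ : ℝ) :
    (D.empCond a y).real {x | κ + τ * dualNorm nrm c ≤ c ⬝ᵥ x + β} ≤
      μ.real {x | κ ≤ c ⬝ᵥ x + β} := by
  have hτ0 : 0 < τ := by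
    by_contra! h
    rw [ENNReal.ofReal_of_nonpos h] at hτ
    exact not_lt_bot hτ
  simp only [wassInf, iInf_lt_iff] at hτ
  obtain ⟨π, ⟨h1, h2⟩, hlt⟩ := hτ
  rw [← h1, ← h2, map_measureReal_apply measurable_snd (measurableSet_halfspace_ge c β _),
    map_measureReal_apply measurable_fst (measurableSet_halfspace_ge c β _)]
  have hfin : IsFiniteMeasure π := by
    constructor
    have := congrArg (fun m => m univ) h1
    simp only [Measure.map_apply measurable_fst MeasurableSet.univ, preimage_univ] at this
    rw [this]
    exact measure_lt_top _ _
  refine ENNReal.toReal_mono (measure_ne_top _ _) (measure_mono_ae ?_)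
  filter_upwards [ae_lt_of_essSup_lt hlt] with z hz hmem
  rw [ENNReal.ofReal_lt_ofReal_iff hτ0] at hz
  have h3 := dotProduct_le_mul_dualNorm hnrm c (z.2 - z.1) (r := τ)
    (by rw [map_sub_rev]; exact hz.le)
  rw [dotProduct_sub] at h3
  change κ ≤ c ⬝ᵥ z.1 + β
  have h4 : κ + τ * dualNorm nrm c ≤ c ⬝ᵥ z.2 + β := hmem
  linarith

/-- No distribution in the Wasserstein ball gives the open halfspace more mass than the fraction of
movable samples. The couplings displace points by at most `ρ + γ` for every `γ > 0`, and the closed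
halfspaces `κ - γ * dualNorm nrm c ≤ c ⬝ᵥ x + β` decrease to the complement as `γ → 0`. -/
theorem real_halfspace_le_movableFrac (hnrm : ∀ x, nrm x = 0 → x = 0)
    {a : Attr} {y : Label} (hne : (D.group a y).Nonempty) (hρ : 0 ≤ ρ a y)
    {μ : Measure (Fin d → ℝ)} (hμ : μ ∈ condBall nrm D ρ a y) (c : Fin d → ℝ) (β κ : ℝ) :
    μ.real {x | c ⬝ᵥ x + β < κ} ≤ movableFrac nrm D ρ a y c β κ := by
  classical
  obtain ⟨hprob, hW⟩ := hμ
  set A : ℕ → Set (Fin d → ℝ) := fun n =>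
    {x | κ - 1 / ((n : ℝ) + 1) * dualNorm nrm c ≤ c ⬝ᵥ x + β} with hA
  set q := (D.empCond a y).real {x | κ + ρ a y * dualNorm nrm c ≤ c ⬝ᵥ x + β} with hq
  have hbound : ∀ n, q ≤ μ.real (A n) := by
    intro n
    have hpos : (0 : ℝ) < 1 / ((n : ℝ) + 1) := by positivity
    have hlt : wassInf nrm μ (D.empCond a y) < ENNReal.ofReal (ρ a y + 1 / ((n : ℝ) + 1)) :=
      hW.trans_lt ((ENNReal.ofReal_lt_ofReal_iff (by linarith)).2 (by linarith))
    have h := le_real_halfspace_of_wassInf_lt hnrm hlt c β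
      (κ - 1 / ((n : ℝ) + 1) * dualNorm nrm c)
    convert h using 5
    ring
  have hlim : Filter.Tendsto (fun n => μ.real (A n)) Filter.atTop (nhds (μ.real (⋂ n, A n))) := by
    refine (ENNReal.tendsto_toReal (measure_ne_top _ _)).comp
      (tendsto_measure_iInter_atTop (fun n => (measurableSet_halfspace_ge c β _).nullMeasurableSet)
        ?_ ⟨0, measure_ne_top _ _⟩)
    intro m n hmn x hx
    have hx : κ - 1 / ((n : ℝ) + 1) * dualNorm nrm c ≤ c ⬝ᵥ x + β := hx
    change κ - 1 / ((m : ℝ) + 1) * dualNorm nrm c ≤ c ⬝ᵥ x + β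
    have := mul_le_mul_of_nonneg_right (Nat.one_div_le_one_div (α := ℝ) hmn)
      (dualNorm_nonneg hnrm c)
    linarith
  have hInter : (⋂ n, A n) = {x | c ⬝ᵥ x + β < κ}ᶜ := by
    ext x
    simp only [hA, mem_iInter, mem_ofPred_eq, mem_compl_iff, not_lt]
    constructor
    · intro h
      have hl : Filter.Tendsto (fun n : ℕ => κ - 1 / ((n : ℝ) + 1) * dualNorm nrm c) Filter.atTop
          (nhds (κ - 0 * dualNorm nrm c)) :=
        (tendsto_one_div_add_atTop_nhds_zero_nat.mul_const _).const_sub _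
      rw [zero_mul, sub_zero] at hl
      exact le_of_tendsto' hl h
    · intro h n
      have : 0 ≤ 1 / ((n : ℝ) + 1) * dualNorm nrm c :=
        mul_nonneg (by positivity) (dualNorm_nonneg hnrm c)
      linarith
  have hge := ge_of_tendsto' hlim hbound
  rw [hInter, probReal_compl_eq_one_sub (measurableSet_halfspace_lt c β κ)] at hge
  have hq' : q = 1 - movableFrac nrm D ρ a y c β κ := by
    have : IsProbabilityMeasure (D.empCond a y) := isProbabilityMeasure_empirical hne D.x
    have hset : {x : Fin d → ℝ | κ + ρ a y * dualNorm nrm c ≤ c ⬝ᵥ x + β} =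
        {x | c ⬝ᵥ x + β < κ + ρ a y * dualNorm nrm c}ᶜ := by
      ext x; simp
    rw [hq, hset, probReal_compl_eq_one_sub (measurableSet_halfspace_lt c β _)]
    congr 1
    exact empirical_real _ D.x (measurableSet_halfspace_lt c β _)
  linarith

/-- Translating every sample of the group by `-ρ u`, where `u` attains the dual norm of `c`, yields
a distribution in the Wasserstein ball that moves all movable samples into the halfspace. -/
theorem exists_condBall_real_halfspace_eq (hnrm : ∀ x, nrm x = 0 → x = 0)
    {a : Attr} {y : Label} (hne : (D.group a y).Nonempty) (hρ : 0 ≤ ρ a y)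
    (c : Fin d → ℝ) (β κ : ℝ) :
    ∃ μ ∈ condBall nrm D ρ a y,
      μ.real {x | c ⬝ᵥ x + β < κ} = movableFrac nrm D ρ a y c β κ := by
  classical
  obtain ⟨u, hu, he⟩ := exists_dotProduct_eq_dualNorm hnrm c
  set f : Fin N → Fin d → ℝ := fun i => D.x i - ρ a y • u with hf
  refine ⟨empirical (D.group a y) f, ⟨isProbabilityMeasure_empirical hne f, ?_⟩, ?_⟩
  · have hπ : IsCoupling (empirical (D.group a y) fun i => (f i, D.x i))
        (empirical (D.group a y) f) (D.empCond a y) :=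
      ⟨map_empirical _ _ measurable_fst, map_empirical _ _ measurable_snd⟩
    have hle : wassInf nrm (empirical (D.group a y) f) (D.empCond a y) ≤
        essSup (fun z => ENNReal.ofReal (nrm (z.1 - z.2)))
          (empirical (D.group a y) fun i => (f i, D.x i)) :=
      iInf_le_of_le _ (iInf_le_of_le hπ le_rfl)
    refine hle.trans (essSup_le_of_ae_le _ (ae_empirical _ _ ?_ fun i _ => ?_))
    · refine measurableSet_le (Measurable.ennreal_ofReal ?_) measurable_const
      exact ((continuous_seminorm_pi nrm).comp (continuous_fst.sub continuous_snd)).measurable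
    · refine ENNReal.ofReal_le_ofReal ?_
      have : f i - D.x i = -(ρ a y • u) := by simp [hf]
      change nrm (f i - D.x i) ≤ _
      rw [this, map_neg_eq_map, map_smul_eq_mul, Real.norm_of_nonneg hρ]
      exact mul_le_of_le_one_right hρ hu
  · rw [empirical_real _ _ (measurableSet_halfspace_lt c β κ), movableFrac, movable]
    congr 3
    refine Finset.filter_congr fun i _ => ?_
    simp only [hf, mem_ofPred_eq, dotProduct_sub, dotProduct_smul, he, smul_eq_mul]
    constructor <;> intro h <;> linarith

end Halfspace

/-! ### Duality for the `χ²`-ball -/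

section Duality

variable {ι : Type*} [Fintype ι]

/-- The second-order cone constraint of the program is the rotated cone constraint
`r ^ 2 ≤ ζ * (ζ - s - θ)`. -/
theorem sqrt_le_iff_sq_le {ζ s θ r : ℝ} (hζ : 0 ≤ ζ) (hs : s + θ ≤ ζ) :
    Real.sqrt (4 * r ^ 2 + (s + θ) ^ 2) ≤ 2 * ζ - s - θ ↔ r ^ 2 ≤ ζ * (ζ - s - θ) := by
  rw [Real.sqrt_le_iff]
  constructor
  · rintro ⟨-, h⟩
    nlinarith
  · intro h
    exact ⟨by linarith, by nlinarith⟩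

/-- Weak duality, which holds term by term: `p s ≤ ζ (p - q)² / p - θ p - 2 q r + 2 ζ q` because
`2 p q r ≤ 2 p q √(ζ (ζ - s - θ)) ≤ p² (ζ - s - θ) + ζ q²`. -/
theorem sum_mul_le_dual {p q s r : ι → ℝ} {δ ζ θ : ℝ} (hp : ∀ i, 0 < p i) (hp1 : ∑ i, p i = 1)
    (hpδ : ∑ i, (p i - q i) ^ 2 / p i ≤ δ) (hζ : 0 ≤ ζ) (hs : ∀ i, s i + θ ≤ ζ)
    (hr : ∀ i, r i ^ 2 ≤ ζ * (ζ - s i - θ)) :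
    ∑ i, p i * s i ≤ δ * ζ - θ - 2 * (∑ i, q i * r i) + 2 * ζ * ∑ i, q i := by
  have hterm : ∀ i, p i * s i ≤
      ζ * ((p i - q i) ^ 2 / p i) - θ * p i - 2 * (q i * r i) + 2 * ζ * q i := by
    intro i
    have hpi := hp i
    have hu : 0 ≤ ζ - s i - θ := by linarith [hs i]
    have habs : |2 * p i * q i * r i| ≤ p i ^ 2 * (ζ - s i - θ) + ζ * q i ^ 2 := by
      refine abs_le_of_sq_le_sq ?_ (by positivity)
      have h1 : (p i * q i) ^ 2 * r i ^ 2 ≤ (p i * q i) ^ 2 * (ζ * (ζ - s i - θ)) :=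
        mul_le_mul_of_nonneg_left (hr i) (sq_nonneg _)
      nlinarith [sq_nonneg (p i ^ 2 * (ζ - s i - θ) - ζ * q i ^ 2)]
    have h2 := (le_abs_self _).trans habs
    have hid : ζ * ((p i - q i) ^ 2 / p i) - θ * p i - 2 * (q i * r i) + 2 * ζ * q i - p i * s i =
        (p i ^ 2 * (ζ - s i - θ) + ζ * q i ^ 2 - 2 * p i * q i * r i) / p i := by
      field_simp
      ring
    have h3 : 0 ≤ (p i ^ 2 * (ζ - s i - θ) + ζ * q i ^ 2 - 2 * p i * q i * r i) / p i :=
      div_nonneg (by linarith) hpi.le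
    linarith
  have hsum := Finset.sum_le_sum fun i (_ : i ∈ Finset.univ) => hterm i
  simp only [Finset.sum_add_distrib, Finset.sum_sub_distrib, ← Finset.mul_sum, hp1] at hsum
  have := mul_le_mul_of_nonneg_left hpδ hζ
  linarith

/-- For nonconstant `s` the function `τ ↦ (∑ q / √(τ - s)) (∑ q √(τ - s))` on `τ > max s` takes
every value `1 + δ > 1`: it exceeds `1 + δ` near `max s`, and is at most `√(1 + δ)` for large
`τ`. -/
theorem exists_sum_div_sqrt_mul_sum_mul_sqrt_eq {q s : ι → ℝ} {δ : ℝ} (hq : ∀ i, 0 < q i)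
    (hq1 : ∑ i, q i = 1) (hδ : 0 < δ) (hs : ∃ i j, s i ≠ s j) :
    ∃ τ, (∀ i, s i < τ) ∧
      (∑ i, q i / Real.sqrt (τ - s i)) * (∑ i, q i * Real.sqrt (τ - s i)) = 1 + δ := by
  obtain ⟨i', j', hij⟩ := hs
  have : Nonempty ι := ⟨i'⟩
  obtain ⟨i₁, hmax⟩ := Finite.exists_max s
  obtain ⟨i₀, hmin⟩ := Finite.exists_min s
  have hlt : s i₀ < s i₁ := by
    rcases hij.lt_or_gt with h | h
    · linarith [hmin i', hmax j']
    · linarith [hmin j', hmax i']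
  set L := s i₁ - s i₀ with hL
  have hL0 : 0 < L := by linarith
  set h : ℝ → ℝ := fun τ =>
    (∑ i, q i / Real.sqrt (τ - s i)) * (∑ i, q i * Real.sqrt (τ - s i)) with hh
  have hcont : ContinuousOn h (Ioi (s i₁)) := by
    refine ContinuousOn.mul (continuousOn_finsetSum _ fun i _ => ?_)
      (continuousOn_finsetSum _ fun i _ => ?_)
    · refine ContinuousOn.div continuousOn_const (by fun_prop) fun τ hτ => ?_
      have hτ : s i₁ < τ := hτ
      exact (Real.sqrt_pos.2 (by linarith [hmax i])).ne'
    · fun_prop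
  -- near `max s` one term of each factor suffices
  set k := q i₁ * q i₀ / (1 + δ) with hk
  have hk0 : 0 < k := div_pos (mul_pos (hq _) (hq _)) (by linarith)
  have hκ₁ : 0 < k ^ 2 * L := by positivity
  have hlow : 1 + δ ≤ h (s i₁ + k ^ 2 * L) := by
    have hA : q i₁ / (k * Real.sqrt L) ≤ ∑ i, q i / Real.sqrt (s i₁ + k ^ 2 * L - s i) := by
      have h1 := Finset.single_le_sum (f := fun i => q i / Real.sqrt (s i₁ + k ^ 2 * L - s i))
        (fun i _ => div_nonneg (hq i).le (Real.sqrt_nonneg _)) (Finset.mem_univ i₁)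
      refine le_trans (le_of_eq ?_) h1
      rw [add_sub_cancel_left, Real.sqrt_mul (by positivity), Real.sqrt_sq hk0.le]
    have hB : q i₀ * Real.sqrt L ≤ ∑ i, q i * Real.sqrt (s i₁ + k ^ 2 * L - s i) := by
      have h1 := Finset.single_le_sum (f := fun i => q i * Real.sqrt (s i₁ + k ^ 2 * L - s i))
        (fun i _ => mul_nonneg (hq i).le (Real.sqrt_nonneg _)) (Finset.mem_univ i₀)
      refine le_trans (mul_le_mul_of_nonneg_left (Real.sqrt_le_sqrt ?_) (hq _).le) h1
      linarith
    have hsL : 0 < Real.sqrt L := Real.sqrt_pos.2 hL0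
    have hmul := mul_le_mul hA hB (mul_nonneg (hq _).le hsL.le)
      (Finset.sum_nonneg fun i _ => div_nonneg (hq i).le (Real.sqrt_nonneg _))
    refine le_trans (le_of_eq ?_) hmul
    have h0 := (hq i₀).ne'
    have h1 := (hq i₁).ne'
    have h2 : (1 + δ) ≠ 0 := by linarith
    rw [hk]
    field_simp
  -- at distance `L / δ` from `max s` the two factors are bounded by the extreme terms
  set κ := L / δ with hκ
  have hκ0 : 0 < κ := by positivity
  have hhigh : h (s i₁ + κ) ≤ 1 + δ := by
    have hA : ∑ i, q i / Real.sqrt (s i₁ + κ - s i) ≤ 1 / Real.sqrt κ := by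
      rw [← hq1, Finset.sum_div]
      refine Finset.sum_le_sum fun i _ => div_le_div_of_nonneg_left (hq i).le
        (Real.sqrt_pos.2 hκ0) (Real.sqrt_le_sqrt ?_)
      linarith [hmax i]
    have hB : ∑ i, q i * Real.sqrt (s i₁ + κ - s i) ≤ 1 * Real.sqrt (κ * (1 + δ)) := by
      rw [← hq1, Finset.sum_mul]
      refine Finset.sum_le_sum fun i _ => mul_le_mul_of_nonneg_left (Real.sqrt_le_sqrt ?_) (hq i).le
      have : κ * δ = L := by rw [hκ]; field_simp
      nlinarith [hmin i]
    have hsκ : 0 < Real.sqrt κ := Real.sqrt_pos.2 hκ0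
    refine (mul_le_mul hA hB (Finset.sum_nonneg fun i _ =>
      mul_nonneg (hq i).le (Real.sqrt_nonneg _)) (by positivity)).trans ?_
    rw [Real.sqrt_mul hκ0.le]
    have h1 : 1 / Real.sqrt κ * (1 * (Real.sqrt κ * Real.sqrt (1 + δ))) = Real.sqrt (1 + δ) := by
      field_simp
    rw [h1, Real.sqrt_le_left (by linarith)]
    nlinarith
  obtain ⟨τ, hτ, he⟩ := isPreconnected_Ioi.intermediate_value
    (show s i₁ + κ ∈ Ioi (s i₁) from by simpa using hκ0)
    (show s i₁ + k ^ 2 * L ∈ Ioi (s i₁) from by simpa using hκ₁) hcont ⟨hhigh, hlow⟩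
  exact ⟨τ, fun i => (hmax i).trans_lt hτ, he⟩

/-- Strong duality with attainment for radius `δ > 0`. With `τ = ζ - θ`, the optimality conditions
read `p = q √ζ / √(τ - s)` and `r = √(ζ (τ - s))`, where `τ` and `ζ` are determined by `∑ p = 1` and
by equality in the divergence constraint. -/
theorem exists_primal_eq_dual {q s : ι → ℝ} {δ : ℝ} (hq : ∀ i, 0 < q i)
    (hq1 : ∑ i, q i = 1) (hδ : 0 < δ) :
    ∃ (p r : ι → ℝ) (ζ θ : ℝ), (∀ i, 0 < p i) ∧ ∑ i, p i = 1 ∧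
      ∑ i, (p i - q i) ^ 2 / p i ≤ δ ∧ 0 ≤ ζ ∧ (∀ i, s i + θ ≤ ζ) ∧
      (∀ i, r i ^ 2 ≤ ζ * (ζ - s i - θ)) ∧
      δ * ζ - θ - 2 * (∑ i, q i * r i) + 2 * ζ * ∑ i, q i = ∑ i, p i * s i := by
  by_cases hs : ∃ i j, s i ≠ s j
  · obtain ⟨τ, hτ, he⟩ := exists_sum_div_sqrt_mul_sum_mul_sqrt_eq hq hq1 hδ hs
    set σ : ι → ℝ := fun i => Real.sqrt (τ - s i) with hσ
    have hσ0 : ∀ i, 0 < σ i := fun i => Real.sqrt_pos.2 (by linarith [hτ i])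
    have hσ2 : ∀ i, σ i ^ 2 = τ - s i := fun i => Real.sq_sqrt (by linarith [hτ i])
    set A := ∑ i, q i / σ i with hA
    set B := ∑ i, q i * σ i with hB
    have hAB : A * B = 1 + δ := he
    have hne : (Finset.univ : Finset ι).Nonempty := by
      obtain ⟨i, -⟩ := hs
      exact ⟨i, Finset.mem_univ i⟩
    have hA0 : 0 < A := Finset.sum_pos (fun i _ => div_pos (hq i) (hσ0 i)) hne
    have hp1 : ∑ i, q i / (A * σ i) = 1 := by
      have : ∀ i, q i / (A * σ i) = (q i / σ i) / A := fun i => by rw [div_div, mul_comm]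
      simp only [this, ← Finset.sum_div]
      exact div_self hA0.ne'
    have hps : ∑ i, q i / (A * σ i) * s i = τ - B / A := by
      have : ∀ i, q i / (A * σ i) * s i = q i / (A * σ i) * τ - q i * σ i / A := fun i => by
        have h1 : s i = τ - σ i ^ 2 := by rw [hσ2]; ring
        have := (hσ0 i).ne'
        rw [h1]
        field_simp
      simp only [this, Finset.sum_sub_distrib, ← Finset.sum_mul, ← Finset.sum_div, hp1, one_mul]
      rfl
    refine ⟨fun i => q i / (A * σ i), fun i => σ i / A, 1 / A ^ 2, 1 / A ^ 2 - τ,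
      fun i => div_pos (hq i) (mul_pos hA0 (hσ0 i)), hp1, ?_, by positivity, fun i => ?_,
      fun i => ?_, ?_⟩
    · have : ∀ i, (q i / (A * σ i) - q i) ^ 2 / (q i / (A * σ i)) =
          q i / (A * σ i) - 2 * q i + A * (q i * σ i) := fun i => by
        have h1 := (hσ0 i).ne'
        have h2 := (hq i).ne'
        field_simp
        ring
      simp only [this, Finset.sum_add_distrib, Finset.sum_sub_distrib, ← Finset.mul_sum, hp1, hq1]
      rw [← hB, hAB]
      linarith
    · linarith [hτ i]
    · rw [div_pow, hσ2]
      apply le_of_eq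
      ring
    · have h1 : ∑ i, q i * (σ i / A) = B / A := by
        simp only [← mul_div_assoc, ← Finset.sum_div]
        rfl
      have h2 : B / A = (1 + δ) / A ^ 2 := by
        rw [← hAB]
        field_simp
      simp only [h1, hps, hq1, h2]
      ring
  · push Not at hs
    have hne : Nonempty ι := by
      by_contra h
      rw [not_nonempty_iff] at h
      simp at hq1
    obtain ⟨i₀⟩ := hne
    refine ⟨q, fun _ => 0, 0, -s i₀, hq, hq1, by simpa using hδ.le, le_rfl, fun i => ?_,
      by simp, ?_⟩
    · rw [hs i i₀]; simp
    · simp [fun i => hs i i₀, ← Finset.sum_mul, hq1]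

/-- For radius `0` the ball is a single point, and the dual bound is approached along
`ζ → ∞` with `θ = 0` and `r = ζ - s / 2 - 1 / ζ`, a lower bound for
`√(ζ (ζ - s))` with an error of order `1 / ζ`. -/
theorem exists_dual_le_add {q s : ι → ℝ} (hq1 : ∑ i, q i = 1)
    (hs0 : ∀ i, 0 ≤ s i) (hs1 : ∀ i, s i ≤ 1) {γ : ℝ} (hγ : 0 < γ) :
    ∃ (r : ι → ℝ) (ζ θ : ℝ), 0 ≤ ζ ∧ (∀ i, s i + θ ≤ ζ) ∧
      (∀ i, r i ^ 2 ≤ ζ * (ζ - s i - θ)) ∧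
      0 * ζ - θ - 2 * (∑ i, q i * r i) + 2 * ζ * ∑ i, q i ≤ (∑ i, q i * s i) + γ := by
  set ζ := max 2 (2 / γ) with hζ
  have hζ2 : 2 ≤ ζ := le_max_left _ _
  have hζγ : 2 / ζ ≤ γ := by
    rw [div_le_iff₀ (by linarith), mul_comm, ← div_le_iff₀ hγ]
    exact le_max_right _ _
  refine ⟨fun i => ζ - s i / 2 - 1 / ζ, ζ, 0, by linarith, fun i => by linarith [hs1 i],
    fun i => ?_, ?_⟩
  · have hκ0 : 0 < 1 / ζ := by positivity
    have hκ1 : 1 / ζ ≤ 1 / 2 := by gcongr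
    have hκζ : ζ * (1 / ζ) = 1 := by field_simp
    simp only
    generalize 1 / ζ = κ at hκ0 hκ1 hκζ ⊢
    nlinarith [hs0 i, hs1 i, mul_le_mul (hs1 i) hκ1 hκ0.le zero_le_one,
      mul_nonneg (hs0 i) (sub_nonneg.2 (hs1 i)), mul_le_mul hκ1 hκ1 hκ0.le (by norm_num)]
  · have : ∀ i, q i * (ζ - s i / 2 - 1 / ζ) = q i * ζ - q i * s i / 2 - q i * (1 / ζ) :=
      fun i => by ring
    simp only [this, Finset.sum_sub_distrib, ← Finset.sum_mul, ← Finset.sum_div, hq1]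
    have : 2 * (1 / ζ) = 2 / ζ := by ring
    linarith

end Duality

/-! ### Probabilities under the joint distributions -/

section Joint

variable {d N : ℕ} {nrm : Seminorm ℝ (Fin d → ℝ)} {D : Samples d N} {ρ : Attr → Label → ℝ}

/-- The `σ`-algebra on the labels is the one pulled back from `ℤ`. -/
instance : MeasurableSingletonClass Label :=
  ⟨fun y => ⟨{(y : ℤ)}, measurableSet_singleton _, by ext; simp [Units.ext_iff]⟩⟩

/-- `Q` has the group weights `p` and the conditional distributions `μ`. -/
def HasGroupLaws (Q : Measure (Outcome d)) (p : Attr → Label → ℝ)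
    (μ : Attr → Label → Measure (Fin d → ℝ)) : Prop :=
  ∀ (S : Set (Fin d → ℝ)), MeasurableSet S → ∀ a y,
    Q (S ×ˢ ({a} ×ˢ {y})) = ENNReal.ofReal (p a y) * μ a y S

/-- The law of total probability over the groups. -/
theorem HasGroupLaws.measure_eq {Q : Measure (Outcome d)} {p : Attr → Label → ℝ}
    {μ : Attr → Label → Measure (Fin d → ℝ)} (h : HasGroupLaws Q p μ)
    {S : Attr → Label → Set (Fin d → ℝ)} (hS : ∀ a y, MeasurableSet (S a y)) :
    Q {z | z.1 ∈ S z.2.1 z.2.2} = ∑ a, ∑ y, ENNReal.ofReal (p a y) * μ a y (S a y) := by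
  have hset : {z : Outcome d | z.1 ∈ S z.2.1 z.2.2} =
      ⋃ k : Attr × Label, S k.1 k.2 ×ˢ ({k.1} ×ˢ {k.2}) := by
    ext ⟨x, a, y⟩
    simp
  have hdisj : Pairwise (Function.onFun Disjoint fun k : Attr × Label =>
      S k.1 k.2 ×ˢ (({k.1} : Set Attr) ×ˢ ({k.2} : Set Label))) := by
    intro k l hkl
    rw [Function.onFun, Set.disjoint_left]
    rintro ⟨x, a, y⟩ ⟨-, h1, h2⟩ ⟨-, h3, h4⟩
    exact hkl (Prod.ext (h1.symm.trans h3) (h2.symm.trans h4))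
  rw [hset, measure_iUnion hdisj fun k => (hS _ _).prod
    ((measurableSet_singleton _).prod (measurableSet_singleton _)), tsum_fintype,
    Fintype.sum_prod_type]
  simp only [h _ (hS _ _)]

theorem HasGroupLaws.real_eq {Q : Measure (Outcome d)} {p : Attr → Label → ℝ}
    {μ : Attr → Label → Measure (Fin d → ℝ)} (h : HasGroupLaws Q p μ) (hp : ∀ a y, 0 < p a y)
    (hμ : ∀ a y, IsProbabilityMeasure (μ a y))
    {S : Attr → Label → Set (Fin d → ℝ)} (hS : ∀ a y, MeasurableSet (S a y)) :
    Q.real {z | z.1 ∈ S z.2.1 z.2.2} = ∑ a, ∑ y, p a y * (μ a y).real (S a y) := by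
  have hfin : ∀ a y, ENNReal.ofReal (p a y) * μ a y (S a y) ≠ ∞ := fun a y =>
    ENNReal.mul_ne_top ENNReal.ofReal_ne_top (measure_ne_top _ _)
  rw [measureReal_def, h.measure_eq hS, ENNReal.toReal_sum fun a _ =>
    (ENNReal.sum_lt_top.2 fun y _ => (hfin a y).lt_top).ne]
  refine Finset.sum_congr rfl fun a _ => ?_
  rw [ENNReal.toReal_sum fun y _ => hfin a y]
  refine Finset.sum_congr rfl fun y _ => ?_
  rw [ENNReal.toReal_mul, ENNReal.toReal_ofReal (hp a y).le, measureReal_def]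

/-- The distributions `μ a y` are the conditional laws of `X` given `A = a`, `Y = y`. -/
theorem HasGroupLaws.condProb_eq {Q : Measure (Outcome d)} {p : Attr → Label → ℝ}
    {μ : Attr → Label → Measure (Fin d → ℝ)} (h : HasGroupLaws Q p μ) (hp : ∀ a y, 0 < p a y)
    (hμ : ∀ a y, IsProbabilityMeasure (μ a y)) {S : Set (Fin d → ℝ)} (hS : MeasurableSet S)
    (a : Attr) (y : Label) : condProb Q a y S = (μ a y).real S := by
  have hG : groupEvent (d := d) a y = univ ×ˢ ({a} ×ˢ {y}) := by
    ext ⟨x, a', y'⟩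
    simp [groupEvent]
  have hGS : univ ×ˢ ({a} ×ˢ {y}) ∩ {z : Outcome d | z.1 ∈ S} = S ×ˢ ({a} ×ˢ {y}) := by
    ext ⟨x, a', y'⟩
    simp [and_comm]
  have hGm : MeasurableSet (groupEvent (d := d) a y) := by
    rw [hG]
    exact MeasurableSet.univ.prod ((measurableSet_singleton _).prod (measurableSet_singleton _))
  have hp0 : ENNReal.ofReal (p a y) ≠ 0 := by simpa using hp a y
  rw [condProb, measureReal_def, ProbabilityTheory.cond_apply hGm, hG, hGS, h _ hS,
    h _ MeasurableSet.univ, measure_univ, mul_one, ← mul_assoc,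
    ENNReal.inv_mul_cancel hp0 ENNReal.ofReal_ne_top, one_mul, measureReal_def]

/-- Any weights in the `χ²`-ball and any distributions in the Wasserstein balls are the group laws
of a member of the ambiguity set. -/
theorem exists_mem_ambiguitySet {δ : ℝ} {p : Attr → Label → ℝ} (hp : p ∈ chiBall D δ)
    {μ : Attr → Label → Measure (Fin d → ℝ)} (hμ : ∀ a y, μ a y ∈ condBall nrm D ρ a y) :
    ∃ Q ∈ ambiguitySet nrm D ρ δ, HasGroupLaws Q p μ := by
  set Q : Measure (Outcome d) := ∑ a, ∑ y,
    ENNReal.ofReal (p a y) • (μ a y).map (fun x => (x, a, y)) with hQ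
  have hmeas : ∀ (a : Attr) (y : Label), Measurable fun x : Fin d → ℝ => (x, a, y) :=
    fun a y => measurable_id.prodMk measurable_const
  have hlaw : HasGroupLaws Q p μ := by
    intro S hS a y
    have hm : MeasurableSet (S ×ˢ (({a} : Set Attr) ×ˢ ({y} : Set Label))) :=
      hS.prod ((measurableSet_singleton _).prod (measurableSet_singleton _))
    simp only [hQ, Measure.finsetSum_apply, Measure.smul_apply, smul_eq_mul,
      Measure.map_apply (hmeas _ _) hm]
    rw [Finset.sum_eq_single a, Finset.sum_eq_single y]
    · congr 2
      ext x
      simp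
    · intro y' _ hy'
      have : (fun x : Fin d → ℝ => (x, a, y')) ⁻¹' S ×ˢ ({a} ×ˢ {y}) = ∅ := by
        ext x
        simp [hy']
      rw [this, measure_empty, mul_zero]
    · exact fun h => absurd (Finset.mem_univ _) h
    · intro a' _ ha'
      refine Finset.sum_eq_zero fun y' _ => ?_
      have : (fun x : Fin d → ℝ => (x, a', y')) ⁻¹' S ×ˢ ({a} ×ˢ {y}) = ∅ := by
        ext x
        simp [ha']
      rw [this, measure_empty, mul_zero]
    · exact fun h => absurd (Finset.mem_univ _) h
  have hprob : IsProbabilityMeasure Q := by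
    constructor
    have h := hlaw.measure_eq (S := fun _ _ => univ) fun _ _ => MeasurableSet.univ
    have h1 : ∀ a y, μ a y univ = 1 := fun a y => (hμ a y).1.measure_univ
    have hnn : ∀ a y, 0 ≤ p a y := fun a y => (hp.1 a y).le
    simp only [mem_univ, ofPred_true, h1, mul_one] at h
    rw [h]
    simp only [← ENNReal.ofReal_sum_of_nonneg fun y _ => hnn _ y]
    rw [← ENNReal.ofReal_sum_of_nonneg fun a _ => Finset.sum_nonneg fun y _ => hnn a y, hp.2.1,
      ENNReal.ofReal_one]
  exact ⟨Q, ⟨hprob, μ, p, hlaw, hp, hμ⟩, hlaw⟩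

theorem card_pos_of_groups (hD : ∀ a y, (D.group a y).Nonempty) : (0 : ℝ) < N := by
  obtain ⟨i, -⟩ := hD 0 1
  exact_mod_cast Fin.pos i

theorem phat_pos (hD : ∀ a y, (D.group a y).Nonempty) (a : Attr) (y : Label) : 0 < D.phat a y :=
  div_pos (card_group_pos hD a y) (card_pos_of_groups hD)

theorem sum_phat (hD : ∀ a y, (D.group a y).Nonempty) : ∑ a, ∑ y, D.phat a y = 1 := by
  have hN := card_pos_of_groups hD
  simp only [Samples.phat, ← Finset.sum_div]
  rw [div_eq_one_iff_eq hN.ne']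
  have h := Finset.card_eq_sum_card_fiberwise (s := (Finset.univ : Finset (Fin N)))
    (t := (Finset.univ : Finset (Attr × Label))) (f := fun i => (D.a i, D.y i))
    (fun _ _ => Finset.mem_coe.2 (Finset.mem_univ _))
  rw [Finset.card_univ, Fintype.card_fin, Fintype.sum_prod_type] at h
  simp only [Prod.mk.injEq] at h
  refine Eq.trans ?_ (congrArg (Nat.cast (R := ℝ)) h).symm
  push_cast
  rfl

theorem phat_mem_chiBall (hD : ∀ a y, (D.group a y).Nonempty) {δ : ℝ} (hδ : 0 ≤ δ) :
    D.phat ∈ chiBall D δ :=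
  ⟨phat_pos hD, sum_phat hD, by simpa using hδ⟩

/-! ### The robust problem in terms of movable samples -/

/-- The worst-case `ε`-misclassification probability in a group. -/
noncomputable def worstMis (nrm : Seminorm ℝ (Fin d → ℝ)) (D : Samples d N)
    (ρ : Attr → Label → ℝ) (ε : ℝ) (w : Fin d → ℝ) (b : ℝ) (a : Attr) (y : Label) : ℝ :=
  movableFrac nrm D ρ a y (sgn y • w) (sgn y * b) ε

/-- The worst case of the unfairness term of the ordered pair `(a, a')`: the events
`w ⬝ᵥ x + b > -ε` and `w ⬝ᵥ x + b < 0` are made as likely as possible in the two groups. -/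
noncomputable def worstUnfair (nrm : Seminorm ℝ (Fin d → ℝ)) (D : Samples d N)
    (ρ : Attr → Label → ℝ) (ε : ℝ) (w : Fin d → ℝ) (b : ℝ) (a a' : Attr) : ℝ :=
  movableFrac nrm D ρ a 1 (-w) (-b) ε + movableFrac nrm D ρ a' 1 w b 0 - 1

theorem misclassification_event_eq (ε : ℝ) (w : Fin d → ℝ) (b : ℝ) :
    {z : Outcome d | sgn z.2.2 * (w ⬝ᵥ z.1 + b) < ε} =
      {z | z.1 ∈ {x : Fin d → ℝ | (sgn z.2.2 • w) ⬝ᵥ x + sgn z.2.2 * b < ε}} := by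
  ext z
  simp only [mem_ofPred_eq, smul_dotProduct, smul_eq_mul, mul_add]

theorem positive_event_eq (ε : ℝ) (w : Fin d → ℝ) (b : ℝ) :
    {x : Fin d → ℝ | w ⬝ᵥ x + b > -ε} = {x | (-w) ⬝ᵥ x + -b < ε} := by
  ext x
  simp only [mem_ofPred_eq, neg_dotProduct, gt_iff_lt]
  constructor <;> intro h <;> linarith

theorem nonneg_event_eq (w : Fin d → ℝ) (b : ℝ) :
    {x : Fin d → ℝ | w ⬝ᵥ x + b ≥ 0} = {x | w ⬝ᵥ x + b < 0}ᶜ := by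
  ext x
  simp

variable (hnrm : ∀ x, nrm x = 0 → x = 0) (hD : ∀ a y, (D.group a y).Nonempty)
  (hρ : ∀ a y, 0 ≤ ρ a y)

theorem bddAbove_misclassification (δ ε : ℝ) (w : Fin d → ℝ) (b : ℝ) :
    BddAbove ((fun Q : Measure (Outcome d) => Q.real {z | sgn z.2.2 * (w ⬝ᵥ z.1 + b) < ε}) ''
      ambiguitySet nrm D ρ δ) := by
  refine ⟨1, ?_⟩
  rintro _ ⟨Q, hQ, rfl⟩
  have := hQ.1
  exact measureReal_le_one

include hnrm hD hρ

theorem ambiguitySet_nonempty {δ : ℝ} (hδ : 0 ≤ δ) : (ambiguitySet nrm D ρ δ).Nonempty := by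
  choose μ hμ _ using fun a y =>
    exists_condBall_real_halfspace_eq (D := D) hnrm (hD a y) (hρ a y) 0 0 0
  obtain ⟨Q, hQ, -⟩ := exists_mem_ambiguitySet (phat_mem_chiBall hD hδ) hμ
  exact ⟨Q, hQ⟩

theorem robustObj_le {δ ε v : ℝ} (hδ : 0 ≤ δ) {w : Fin d → ℝ} {b : ℝ}
    (h : ∀ p ∈ chiBall D δ, ∑ a, ∑ y, p a y * worstMis nrm D ρ ε w b a y ≤ v) :
    robustObj nrm D ρ δ ε (w, b) ≤ v := by
  refine csSup_le ((ambiguitySet_nonempty hnrm hD hρ hδ).image _) ?_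
  rintro _ ⟨Q, ⟨-, μ, p, hlaw, hp, hμ⟩, rfl⟩
  refine le_trans ?_ (h p hp)
  have h1 := HasGroupLaws.real_eq hlaw hp.1 (fun a y => (hμ a y).1)
    (S := fun _ y => {x : Fin d → ℝ | (sgn y • w) ⬝ᵥ x + sgn y * b < ε})
    fun _ y => measurableSet_halfspace_lt _ _ _
  simp only
  rw [misclassification_event_eq, h1]
  refine Finset.sum_le_sum fun a _ => Finset.sum_le_sum fun y _ =>
    mul_le_mul_of_nonneg_left ?_ (hp.1 a y).le
  exact real_halfspace_le_movableFrac hnrm (hD a y) (hρ a y) (hμ a y) _ _ _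

theorem le_robustObj {δ : ℝ} (ε : ℝ) (w : Fin d → ℝ) (b : ℝ) {p : Attr → Label → ℝ}
    (hp : p ∈ chiBall D δ) :
    ∑ a, ∑ y, p a y * worstMis nrm D ρ ε w b a y ≤ robustObj nrm D ρ δ ε (w, b) := by
  choose μ hμ he using fun a y => exists_condBall_real_halfspace_eq (D := D) hnrm (hD a y)
    (hρ a y) (sgn y • w) (sgn y * b) ε
  obtain ⟨Q, hQ, hlaw⟩ := exists_mem_ambiguitySet hp hμ
  refine le_trans (le_of_eq ?_) (le_csSup (bddAbove_misclassification δ ε w b)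
    (mem_image_of_mem _ hQ))
  have h1 := HasGroupLaws.real_eq hlaw hp.1 (fun a y => (hμ a y).1)
    (S := fun _ y => {x : Fin d → ℝ | (sgn y • w) ⬝ᵥ x + sgn y * b < ε})
    fun _ y => measurableSet_halfspace_lt _ _ _
  simp only
  rw [misclassification_event_eq, h1]
  simp only [he]
  rfl

/-- An unfairness term is at most its worst case, and every worst case is reached. -/
theorem mem_robustFeasible_iff {δ ε η : ℝ} (hδ : 0 ≤ δ) {w : Fin d → ℝ} {b : ℝ} :
    (w, b) ∈ robustFeasible nrm D ρ δ ε η ↔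
      ∀ a a' : Attr, a ≠ a' → worstUnfair nrm D ρ ε w b a a' ≤ η := by
  have hterm : ∀ {Q : Measure (Outcome d)} {p : Attr → Label → ℝ}
      {μ : Attr → Label → Measure (Fin d → ℝ)}, HasGroupLaws Q p μ → (∀ a y, 0 < p a y) →
      (∀ a y, IsProbabilityMeasure (μ a y)) → ∀ a a' : Attr,
      condProb Q a 1 {x | w ⬝ᵥ x + b > -ε} - condProb Q a' 1 {x | w ⬝ᵥ x + b ≥ 0} =
        (μ a 1).real {x | (-w) ⬝ᵥ x + -b < ε} + (μ a' 1).real {x | w ⬝ᵥ x + b < 0} - 1 := by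
    intro Q p μ hlaw hp hμ a a'
    have := hμ a' 1
    rw [positive_event_eq, nonneg_event_eq,
      hlaw.condProb_eq hp hμ (measurableSet_halfspace_lt _ _ _),
      hlaw.condProb_eq hp hμ (measurableSet_halfspace_lt _ _ _).compl,
      probReal_compl_eq_one_sub (measurableSet_halfspace_lt _ _ _)]
    ring
  have hle : ∀ Q ∈ ambiguitySet nrm D ρ δ, unfairness ε w b Q ≤
      max (worstUnfair nrm D ρ ε w b 0 1) (worstUnfair nrm D ρ ε w b 1 0) := by
    rintro Q ⟨-, μ, p, hlaw, hp, hμ⟩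
    have hb : ∀ a a' : Attr, condProb Q a 1 {x | w ⬝ᵥ x + b > -ε} -
        condProb Q a' 1 {x | w ⬝ᵥ x + b ≥ 0} ≤ worstUnfair nrm D ρ ε w b a a' := by
      intro a a'
      rw [hterm hlaw hp.1 (fun a y => (hμ a y).1)]
      have h1 := real_halfspace_le_movableFrac hnrm (hD a 1) (hρ a 1) (hμ a 1) (-w) (-b) ε
      have h2 := real_halfspace_le_movableFrac hnrm (hD a' 1) (hρ a' 1) (hμ a' 1) w b 0
      unfold worstUnfair
      linarith
    exact max_le_max (hb 0 1) (hb 1 0)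
  constructor
  · intro h a a' haa
    choose μ hμ he using fun k y => exists_condBall_real_halfspace_eq (D := D) hnrm (hD k y)
      (hρ k y) (if k = a then -w else w) (if k = a then -b else b) (if k = a then ε else 0)
    obtain ⟨Q, hQ, hlaw⟩ := exists_mem_ambiguitySet (phat_mem_chiBall hD hδ) hμ
    have hbdd : BddAbove (unfairness ε w b '' ambiguitySet nrm D ρ δ) := by
      refine ⟨max (worstUnfair nrm D ρ ε w b 0 1) (worstUnfair nrm D ρ ε w b 1 0), ?_⟩
      rintro _ ⟨Q, hQ, rfl⟩
      exact hle Q hQ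
    have hsup : sSup (unfairness ε w b '' ambiguitySet nrm D ρ δ) ≤ η := h
    refine le_trans ?_ ((le_csSup hbdd (mem_image_of_mem (unfairness ε w b) hQ)).trans hsup)
    have h1 := he a 1
    have h2 := he a' 1
    simp only [if_true, haa.symm, if_false] at h1 h2
    have h3 := hterm hlaw (phat_pos hD) (fun a y => (hμ a y).1) a a'
    rw [h1, h2] at h3
    refine h3.symm.le.trans ?_
    have : a = 0 ∧ a' = 1 ∨ a = 1 ∧ a' = 0 := by
      revert a a'
      simp only [Fin.forall_fin_two]
      simp
    rcases this with ⟨rfl, rfl⟩ | ⟨rfl, rfl⟩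
    · exact le_max_left _ _
    · exact le_max_right _ _
  · intro h
    refine csSup_le ((ambiguitySet_nonempty hnrm hD hρ hδ).image (unfairness ε w b)) ?_
    rintro _ ⟨Q, hQ, rfl⟩
    exact (hle Q hQ).trans (max_le (h 0 1 (by decide)) (h 1 0 (by decide)))

/-- The zero classifier is never unfair, since both unfairness terms vanish. -/
theorem zero_mem_robustFeasible {δ ε η : ℝ} (hδ : 0 ≤ δ) (hη : 0 ≤ η) :
    ((0 : Fin d → ℝ), (0 : ℝ)) ∈ robustFeasible nrm D ρ δ ε η := by
  rw [mem_robustFeasible_iff hnrm hD hρ hδ]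
  intro a a' _
  have h0 : dualNorm nrm (0 : Fin d → ℝ) = 0 := by
    obtain ⟨u, -, hu⟩ := exists_dotProduct_eq_dualNorm hnrm (0 : Fin d → ℝ)
    simpa using hu.symm
  have h1 : movableFrac nrm D ρ a' 1 0 0 0 = 0 := by
    simp [movableFrac, movable, h0]
  have := movableFrac_le_one (nrm := nrm) (D := D) (ρ := ρ) a 1 (-0) (-0) ε
  unfold worstUnfair
  linarith

/-- The worst-case misclassification probability depends on the classifier only through the sets of
movable samples, so that it takes finitely many values and has a minimizer. -/
theorem exists_isMinOn_robustObj {δ ε η : ℝ} (hδ : 0 ≤ δ) (hη : 0 ≤ η) :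
    ∃ wb ∈ robustFeasible nrm D ρ δ ε η,
      IsMinOn (robustObj nrm D ρ δ ε) (robustFeasible nrm D ρ δ ε η) wb := by
  have hdep : ∀ wb wb' : (Fin d → ℝ) × ℝ,
      (fun (a : Attr) (y : Label) => movable nrm D ρ a y (sgn y • wb.1) (sgn y * wb.2) ε) =
        (fun a y => movable nrm D ρ a y (sgn y • wb'.1) (sgn y * wb'.2) ε) →
      robustObj nrm D ρ δ ε wb ≤ robustObj nrm D ρ δ ε wb' := by
    intro wb wb' h
    refine robustObj_le hnrm hD hρ hδ fun p hp => ?_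
    refine le_trans (le_of_eq ?_) (le_robustObj hnrm hD hρ ε wb'.1 wb'.2 hp)
    refine Finset.sum_congr rfl fun a _ => Finset.sum_congr rfl fun y _ => ?_
    have := congrFun (congrFun h a) y
    rw [worstMis, worstMis, movableFrac, movableFrac, this]
  have hfin : (robustObj nrm D ρ δ ε '' robustFeasible nrm D ρ δ ε η).Finite := by
    refine Set.Finite.of_surjOn (s := (univ : Set (Attr → Label → Finset (Fin N))))
      (fun F => sSup {v | ∃ wb : (Fin d → ℝ) × ℝ, (fun (a : Attr) (y : Label) =>
        movable nrm D ρ a y (sgn y • wb.1) (sgn y * wb.2) ε) = F ∧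
        v = robustObj nrm D ρ δ ε wb}) ?_ (Set.toFinite _)
    rintro _ ⟨wb, -, rfl⟩
    refine ⟨fun a y => movable nrm D ρ a y (sgn y • wb.1) (sgn y * wb.2) ε, mem_univ _, ?_⟩
    have : {v | ∃ wb' : (Fin d → ℝ) × ℝ, (fun (a : Attr) (y : Label) =>
        movable nrm D ρ a y (sgn y • wb'.1) (sgn y * wb'.2) ε) =
          (fun a y => movable nrm D ρ a y (sgn y • wb.1) (sgn y * wb.2) ε) ∧
        v = robustObj nrm D ρ δ ε wb'} = {robustObj nrm D ρ δ ε wb} := by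
      ext v
      constructor
      · rintro ⟨wb', h, rfl⟩
        exact le_antisymm (hdep _ _ h) (hdep _ _ h.symm)
      · rintro rfl
        exact ⟨wb, rfl, rfl⟩
    simp only [this, csSup_singleton]
  obtain ⟨_, ⟨wb, hwb, rfl⟩, hmin⟩ := Set.exists_min_image _ id hfin
    (Set.Nonempty.image _ ⟨_, zero_mem_robustFeasible hnrm hD hρ hδ hη⟩)
  exact ⟨wb, hwb, fun wb' h' => hmin _ (mem_image_of_mem _ h')⟩

end Joint

/-! ### Points of the mixed-binary program -/

section Program

variable {d N : ℕ} {nrm : Seminorm ℝ (Fin d → ℝ)} {D : Samples d N} {ρ : Attr → Label → ℝ}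

theorem abs_sgn (y : Label) : |sgn y| = 1 := by
  rcases Int.units_eq_one_or y with rfl | rfl <;> simp [sgn]

theorem dualNorm_sgn_smul (y : Label) (w : Fin d → ℝ) :
    dualNorm nrm (sgn y • w) = dualNorm nrm w := by
  rcases Int.units_eq_one_or y with rfl | rfl
  · simp [sgn]
  · simp [sgn, dualNorm_neg]

/-- The samples of the group `(a, y)` that the adversary can move into the `ε`-misclassified
region. -/
noncomputable def misclassifiable (nrm : Seminorm ℝ (Fin d → ℝ)) (D : Samples d N)
    (ρ : Attr → Label → ℝ) (ε : ℝ) (w : Fin d → ℝ) (b : ℝ) (a : Attr) (y : Label) :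
    Finset (Fin N) :=
  movable nrm D ρ a y (sgn y • w) (sgn y * b) ε

theorem mem_misclassifiable {ε : ℝ} {w : Fin d → ℝ} {b : ℝ} {a : Attr} {y : Label} {i : Fin N} :
    i ∈ misclassifiable nrm D ρ ε w b a y ↔ i ∈ D.group a y ∧
      -ε < -sgn y * (w ⬝ᵥ D.x i + b) + ρ a y * dualNorm nrm w := by
  unfold misclassifiable movable
  rw [Finset.mem_filter, dualNorm_sgn_smul]
  refine and_congr_right fun _ => ?_
  rw [smul_dotProduct, smul_eq_mul]
  constructor <;> intro h <;> linarith

theorem mem_movable_neg {ε : ℝ} {w : Fin d → ℝ} {b : ℝ} {a : Attr} {y : Label} {i : Fin N} :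
    i ∈ movable nrm D ρ a y (-w) (-b) ε ↔ i ∈ D.group a y ∧
      0 < w ⬝ᵥ D.x i + ρ a y * dualNorm nrm w + b + ε := by
  unfold movable
  rw [Finset.mem_filter, dualNorm_neg]
  refine and_congr_right fun _ => ?_
  rw [neg_dotProduct]
  constructor <;> intro h <;> linarith

theorem mem_movable_zero {w : Fin d → ℝ} {b : ℝ} {a : Attr} {y : Label} {i : Fin N} :
    i ∈ movable nrm D ρ a y w b 0 ↔ i ∈ D.group a y ∧
      0 < -(w ⬝ᵥ D.x i) + ρ a y * dualNorm nrm w - b := by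
  unfold movable
  rw [Finset.mem_filter]
  refine and_congr_right fun _ => ?_
  constructor <;> intro h <;> linarith

theorem mem_group {a : Attr} {y : Label} {i : Fin N} :
    i ∈ D.group a y ↔ D.a i = a ∧ D.y i = y := by
  simp [Samples.group]

/-- Binary variables that vanish at no element of `m` have average at least `|m| / |s|`. -/
theorem card_div_card_le {s m : Finset (Fin N)} {t : Fin N → ℝ} (hm : m ⊆ s)
    (ht : ∀ i, t i = 0 ∨ t i = 1) (h : ∀ i ∈ m, t i ≠ 0) :
    (m.card : ℝ) / s.card ≤ 1 / (s.card : ℝ) * ∑ i ∈ s, t i := by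
  rw [div_eq_mul_one_div, mul_comm]
  refine mul_le_mul_of_nonneg_left ?_ (by positivity)
  have h1 : (m.card : ℝ) = ∑ i ∈ m, t i := by
    rw [Finset.sum_congr rfl fun i hi => (ht i).resolve_left (h i hi)]
    simp
  rw [h1]
  exact Finset.sum_le_sum_of_subset_of_nonneg hm fun i _ _ => by
    rcases ht i with h | h <;> simp [h]

theorem movable_subset (a : Attr) (y : Label) (c : Fin d → ℝ) (β κ : ℝ) :
    movable nrm D ρ a y c β κ ⊆ D.group a y :=
  Finset.filter_subset _ _

/-- A binary variable can only vanish at a sample that is not movable, whatever the value of `M`. -/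
theorem worstMis_le_of_mem_mipFeasible {ε η M : ℝ} {z : Var d N → ℝ}
    (hz : z ∈ mipFeasible nrm D ρ ε η M) (a : Attr) (y : Label) :
    worstMis nrm D ρ ε (classifier z).1 (classifier z).2 a y ≤ z (.s a y) := by
  obtain ⟨-, ht, -, -, -, hs, hM, -⟩ := hz
  refine le_trans (card_div_card_le (t := fun i => z (.t i)) (movable_subset _ _ _ _ _) ht
    fun i hi h0 => ?_) (hs a y)
  obtain ⟨hg, hlt⟩ := mem_misclassifiable.1 hi
  obtain ⟨rfl, rfl⟩ := mem_group.1 hg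
  have h1 := hM i
  rw [h0, mul_zero] at h1
  linarith

theorem worstUnfair_le_of_mem_mipFeasible {ε η M : ℝ} {z : Var d N → ℝ}
    (hz : z ∈ mipFeasible nrm D ρ ε η M) {a a' : Attr} (haa : a ≠ a') :
    worstUnfair nrm D ρ ε (classifier z).1 (classifier z).2 a a' ≤ η := by
  obtain ⟨-, -, hl, -, -, -, -, hF⟩ := hz
  obtain ⟨hsum, h1, h2⟩ := hF a a' haa
  have e1 : movableFrac nrm D ρ a 1 (-(classifier z).1) (-(classifier z).2) ε ≤
      1 / ((D.group a 1).card : ℝ) * ∑ i ∈ D.group a 1, z (.lam a i) :=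
    card_div_card_le (t := fun i => z (.lam a i)) (movable_subset _ _ _ _ _) (hl a)
      fun i hi h0 => by
        obtain ⟨hg, hlt⟩ := mem_movable_neg.1 hi
        have h3 := h1 i hg
        rw [h0, mul_zero] at h3
        linarith
  have e2 : movableFrac nrm D ρ a' 1 (classifier z).1 (classifier z).2 0 ≤
      1 / ((D.group a' 1).card : ℝ) * ∑ i ∈ D.group a' 1, z (.lam a i) :=
    card_div_card_le (t := fun i => z (.lam a i)) (movable_subset _ _ _ _ _) (hl a)
      fun i hi h0 => by
        obtain ⟨hg, hlt⟩ := mem_movable_zero.1 hi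
        have h3 := h2 i hg
        rw [h0, mul_zero] at h3
        linarith
  unfold worstUnfair
  linarith

section

variable (hnrm : ∀ x, nrm x = 0 → x = 0) (hD : ∀ a y, (D.group a y).Nonempty)
  (hρ : ∀ a y, 0 ≤ ρ a y)

include hnrm hD hρ

theorem classifier_mem_robustFeasible {δ ε η M : ℝ} (hδ : 0 ≤ δ) {z : Var d N → ℝ}
    (hz : z ∈ mipFeasible nrm D ρ ε η M) : classifier z ∈ robustFeasible nrm D ρ δ ε η :=
  (mem_robustFeasible_iff hnrm hD hρ hδ).2 fun _ _ haa => worstUnfair_le_of_mem_mipFeasible hz haa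

/-- Weak duality for the program: its objective bounds the worst case from above. -/
theorem robustObj_le_mipObj {δ ε η M : ℝ} (hδ : 0 ≤ δ) {z : Var d N → ℝ}
    (hz : z ∈ mipFeasible nrm D ρ ε η M) :
    robustObj nrm D ρ δ ε (classifier z) ≤ mipObj D δ z := by
  refine robustObj_le hnrm hD hρ hδ fun p hp => ?_
  have hle : ∑ a, ∑ y, p a y * worstMis nrm D ρ ε (classifier z).1 (classifier z).2 a y ≤
      ∑ a, ∑ y, p a y * z (.s a y) :=
    Finset.sum_le_sum fun a _ => Finset.sum_le_sum fun y _ =>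
      mul_le_mul_of_nonneg_left (worstMis_le_of_mem_mipFeasible hz a y) (hp.1 a y).le
  obtain ⟨hζ, -, -, hs, hr, -⟩ := hz
  refine hle.trans ?_
  have h := sum_mul_le_dual (ι := Attr × Label) (p := fun k => p k.1 k.2)
    (q := fun k => D.phat k.1 k.2) (s := fun k => z (.s k.1 k.2)) (r := fun k => z (.r k.1 k.2))
    (δ := δ) (ζ := z .zeta) (θ := z .theta) (fun k => hp.1 _ _)
    (by rw [Fintype.sum_prod_type]; exact hp.2.1) (by rw [Fintype.sum_prod_type]; exact hp.2.2)
    hζ (fun k => hs _ _) (fun k => (sqrt_le_iff_sq_le hζ (hs _ _)).1 (hr _ _))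
  simp only [Fintype.sum_prod_type] at h
  exact h

end

/-- The point of the program that marks exactly the movable samples of the classifier `(w, b)` and
has the given dual variables. The variable `lam a i` concerns the first group of the ordered pair
with first attribute `a` if `D.a i = a`, and the second group otherwise. -/
noncomputable def canonicalPoint (nrm : Seminorm ℝ (Fin d → ℝ)) (D : Samples d N)
    (ρ : Attr → Label → ℝ) (ε : ℝ) (w : Fin d → ℝ) (b ζ θ : ℝ) (r : Attr → Label → ℝ) :
    Var d N → ℝ
  | .w j => w j
  | .b => b
  | .zeta => ζ
  | .theta => θ
  | .r a y => r a y
  | .s a y => worstMis nrm D ρ ε w b a y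
  | .t i => if i ∈ misclassifiable nrm D ρ ε w b (D.a i) (D.y i) then 1 else 0
  | .lam a i => if D.a i = a then (if i ∈ movable nrm D ρ a 1 (-w) (-b) ε then 1 else 0)
      else (if i ∈ movable nrm D ρ (D.a i) 1 w b 0 then 1 else 0)

theorem exists_abs_le (wb : (Fin d → ℝ) × ℝ) : ∃ R : ℝ, (∀ j, |wb.1 j| ≤ R) ∧ |wb.2| ≤ R :=
  ⟨‖wb‖, fun j => (norm_le_pi_norm wb.1 j).trans (norm_fst_le wb), norm_snd_le wb⟩

/-- `M` is so large that a binary variable equal to `1` makes its constraint void. -/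
def IsBigM (nrm : Seminorm ℝ (Fin d → ℝ)) (D : Samples d N) (ρ : Attr → Label → ℝ)
    (ε : ℝ) (w : Fin d → ℝ) (b M : ℝ) : Prop :=
  ∀ i a y, |w ⬝ᵥ D.x i| + |b| + ρ a y * dualNorm nrm w + ε ≤ M

theorem exists_isBigM (hnrm : ∀ x, nrm x = 0 → x = 0) (hρ : ∀ a y, 0 ≤ ρ a y) (ε R : ℝ) :
    ∃ M₀ : ℝ, ∀ M ≥ M₀, ∀ (w : Fin d → ℝ) (b : ℝ), (∀ j, |w j| ≤ R) → |b| ≤ R →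
      IsBigM nrm D ρ ε w b M := by
  obtain ⟨C, hC⟩ := exists_dualNorm_le hnrm R
  obtain ⟨B, hB⟩ := Finite.exists_max (fun o : Option (Fin N) => o.elim 0 fun i => ‖D.x i‖)
  obtain ⟨P, hP⟩ := Finite.exists_max (fun k : Attr × Label => ρ k.1 k.2)
  refine ⟨d * (|R| * (B.elim 0 fun i => ‖D.x i‖)) + |R| + ρ P.1 P.2 * |C| + ε,
    fun M hM w b hw hb i a y => ?_⟩
  have h1 := abs_dotProduct_le w (D.x i) (R := |R|) fun j => (hw j).trans (le_abs_self R)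
  have h2 : (d : ℝ) * (|R| * ‖D.x i‖) ≤ d * (|R| * (B.elim 0 fun i => ‖D.x i‖)) := by
    have := hB (some i)
    gcongr
    exact this
  have h3 : ρ a y * dualNorm nrm w ≤ ρ P.1 P.2 * |C| :=
    mul_le_mul (hP (a, y)) ((hC w hw).trans (le_abs_self C)) (dualNorm_nonneg hnrm w) (hρ _ _)
  linarith [hb.trans (le_abs_self R)]

theorem sum_ite_mem_eq_card {s m : Finset (Fin N)} (hm : m ⊆ s) :
    1 / (s.card : ℝ) * ∑ i ∈ s, (if i ∈ m then (1 : ℝ) else 0) = (m.card : ℝ) / s.card := by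
  rw [Finset.sum_ite_mem, Finset.inter_eq_right.2 hm, Finset.sum_const, nsmul_eq_mul, mul_one,
    one_div_mul_eq_div]

/-- For a large `M`, the canonical point of a fair classifier and feasible dual variables is
feasible in the program. -/
theorem canonicalPoint_mem_mipFiber {ε η M : ℝ} (hε : 0 ≤ ε) {w : Fin d → ℝ} {b : ℝ}
    (hM : IsBigM nrm D ρ ε w b M)
    (hF : ∀ a a' : Attr, a ≠ a' → worstUnfair nrm D ρ ε w b a a' ≤ η)
    {ζ θ : ℝ} {r : Attr → Label → ℝ} (hζ : 0 ≤ ζ)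
    (hs : ∀ a y, worstMis nrm D ρ ε w b a y + θ ≤ ζ)
    (hr : ∀ a y, r a y ^ 2 ≤ ζ * (ζ - worstMis nrm D ρ ε w b a y - θ)) :
    canonicalPoint nrm D ρ ε w b ζ θ r ∈ mipFiber nrm D ρ ε η M (w, b) := by
  have hcl : classifier (canonicalPoint nrm D ρ ε w b ζ θ r) = (w, b) := rfl
  refine ⟨⟨hζ, fun i => ?_, fun a i => ?_, hs,
    fun a y => (sqrt_le_iff_sq_le hζ (hs a y)).2 (hr a y), fun a y => ?_,
    fun i => ?_, fun a a' haa => ⟨?_, fun i hi => ?_, fun i hi => ?_⟩⟩, hcl⟩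
  · simp only [canonicalPoint]
    split_ifs <;> simp
  · simp only [canonicalPoint]
    split_ifs <;> simp
  · refine le_of_eq ?_
    refine Eq.trans ?_ (sum_ite_mem_eq_card
      (movable_subset (nrm := nrm) (ρ := ρ) a y (sgn y • w) (sgn y * b) ε))
    congr 1
    refine Finset.sum_congr rfl fun i hi => ?_
    obtain ⟨rfl, rfl⟩ := mem_group.1 hi
    rfl
  · rw [hcl]
    simp only [canonicalPoint]
    split_ifs with h
    · have h1 := hM i (D.a i) (D.y i)
      have h2 : -sgn (D.y i) * (w ⬝ᵥ D.x i + b) ≤ |w ⬝ᵥ D.x i| + |b| := by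
        refine (le_abs_self _).trans ?_
        rw [abs_mul, abs_neg, abs_sgn, one_mul]
        exact abs_add_le _ _
      linarith
    · rw [mem_misclassifiable, not_and] at h
      have := h (mem_group.2 ⟨rfl, rfl⟩)
      linarith
  · refine le_trans (le_of_eq ?_) (hF a a' haa)
    unfold worstUnfair movableFrac
    rw [← sum_ite_mem_eq_card (movable_subset (nrm := nrm) (ρ := ρ) a 1 (-w) (-b) ε),
      ← sum_ite_mem_eq_card (movable_subset (nrm := nrm) (ρ := ρ) a' 1 w b 0)]
    congr 3
    · refine Finset.sum_congr rfl fun i hi => ?_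
      simp [canonicalPoint, (mem_group.1 hi).1]
    · refine Finset.sum_congr rfl fun i hi => ?_
      simp [canonicalPoint, (mem_group.1 hi).1, haa.symm]
  · rw [hcl]
    simp only [canonicalPoint, (mem_group.1 hi).1, if_true]
    split_ifs with h
    · linarith [hM i a 1, le_abs_self (w ⬝ᵥ D.x i), le_abs_self b]
    · rw [mem_movable_neg, not_and] at h
      have := h hi
      linarith
  · rw [hcl]
    simp only [canonicalPoint, (mem_group.1 hi).1, haa.symm, if_false]
    split_ifs with h
    · have hM' := hM i a' 1
      have := neg_abs_le (w ⬝ᵥ D.x i)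
      have := neg_abs_le b
      linarith
    · rw [mem_movable_zero, not_and] at h
      have := h hi
      linarith

end Program

/-! ### Equivalence of the robust problem and the program -/

section Equivalence

variable {d N : ℕ} {nrm : Seminorm ℝ (Fin d → ℝ)} {D : Samples d N} {ρ : Attr → Label → ℝ}
  (hnrm : ∀ x, nrm x = 0 → x = 0) (hD : ∀ a y, (D.group a y).Nonempty)
  (hρ : ∀ a y, 0 ≤ ρ a y)

include hnrm hD hρ

/-- For `δ > 0` strong duality provides an extension whose objective equals the worst case. -/
theorem exists_mem_mipFiber_eq {δ ε η M : ℝ} (hδ : 0 < δ) (hε : 0 ≤ ε) {w : Fin d → ℝ} {b : ℝ}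
    (hM : IsBigM nrm D ρ ε w b M) (hF : (w, b) ∈ robustFeasible nrm D ρ δ ε η) :
    ∃ z ∈ mipFiber nrm D ρ ε η M (w, b), mipObj D δ z = robustObj nrm D ρ δ ε (w, b) := by
  obtain ⟨p, r, ζ, θ, hp, hp1, hpδ, hζ, hs, hr, he⟩ := exists_primal_eq_dual
    (ι := Attr × Label) (q := fun k => D.phat k.1 k.2)
    (s := fun k => worstMis nrm D ρ ε w b k.1 k.2) (δ := δ) (fun k => phat_pos hD _ _)
    (by rw [Fintype.sum_prod_type]; exact sum_phat hD) hδ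
  have hz := canonicalPoint_mem_mipFiber hε hM ((mem_robustFeasible_iff hnrm hD hρ hδ.le).1 hF)
    (r := fun a y => r (a, y)) hζ (fun a y => hs (a, y)) (fun a y => hr (a, y))
  refine ⟨_, hz, le_antisymm ?_ ?_⟩
  · simp only [Fintype.sum_prod_type] at he hp1 hpδ
    refine (le_of_eq he).trans (le_robustObj hnrm hD hρ ε w b (p := fun a y => p (a, y))
      ⟨fun a y => hp (a, y), hp1, hpδ⟩)
  · exact (congrArg (robustObj nrm D ρ δ ε) hz.2).ge.trans
      (robustObj_le_mipObj hnrm hD hρ hδ.le hz.1)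

/-- The objective of the extensions comes arbitrarily close to the worst case. -/
theorem exists_mem_mipFiber_le_add {δ ε η M γ : ℝ} (hδ : 0 ≤ δ) (hε : 0 ≤ ε) {w : Fin d → ℝ} {b : ℝ}
    (hM : IsBigM nrm D ρ ε w b M) (hF : (w, b) ∈ robustFeasible nrm D ρ δ ε η) (hγ : 0 < γ) :
    ∃ z ∈ mipFiber nrm D ρ ε η M (w, b),
      mipObj D δ z ≤ robustObj nrm D ρ δ ε (w, b) + γ := by
  rcases hδ.eq_or_lt with rfl | hpos
  · obtain ⟨r, ζ, θ, hζ, hs, hr, he⟩ := exists_dual_le_add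
      (ι := Attr × Label) (q := fun k => D.phat k.1 k.2)
      (s := fun k => worstMis nrm D ρ ε w b k.1 k.2)
      (by rw [Fintype.sum_prod_type]; exact sum_phat hD)
      (fun _ => movableFrac_nonneg _ _ _ _ _) (fun _ => movableFrac_le_one _ _ _ _ _) hγ
    have hz := canonicalPoint_mem_mipFiber hε hM ((mem_robustFeasible_iff hnrm hD hρ hδ).1 hF)
      (r := fun a y => r (a, y)) hζ (fun a y => hs (a, y)) (fun a y => hr (a, y))
    refine ⟨_, hz, ?_⟩
    simp only [Fintype.sum_prod_type] at he
    have := le_robustObj hnrm hD hρ ε w b (phat_mem_chiBall hD hδ)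
    exact he.trans (by linarith)
  · obtain ⟨z, hz, he⟩ := exists_mem_mipFiber_eq hnrm hD hρ hpos hε hM hF
    exact ⟨z, hz, by linarith⟩

theorem isGLB_mipObj_mipFiber {δ ε η M : ℝ} (hδ : 0 ≤ δ) (hε : 0 ≤ ε) {w : Fin d → ℝ} {b : ℝ}
    (hM : IsBigM nrm D ρ ε w b M) (hF : (w, b) ∈ robustFeasible nrm D ρ δ ε η) :
    IsGLB (mipObj D δ '' mipFiber nrm D ρ ε η M (w, b)) (robustObj nrm D ρ δ ε (w, b)) := by
  constructor
  · rintro _ ⟨z, ⟨hz, hcl⟩, rfl⟩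
    rw [← hcl]
    exact robustObj_le_mipObj hnrm hD hρ hδ hz
  · intro v hv
    refine le_of_forall_pos_le_add fun γ hγ => ?_
    obtain ⟨z, hz, hle⟩ := exists_mem_mipFiber_le_add hnrm hD hρ hδ hε hM hF hγ
    exact (hv (mem_image_of_mem _ hz)).trans hle

/-- The program has the optimal value of the robust problem as soon as `M` is large for one optimal
classifier. -/
theorem isGLB_mipObj_mipFeasible {δ ε η M : ℝ} (hδ : 0 ≤ δ) (hε : 0 ≤ ε) {wb : (Fin d → ℝ) × ℝ}
    (hM : IsBigM nrm D ρ ε wb.1 wb.2 M) (hF : wb ∈ robustFeasible nrm D ρ δ ε η)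
    (hmin : IsMinOn (robustObj nrm D ρ δ ε) (robustFeasible nrm D ρ δ ε η) wb) :
    IsGLB (mipObj D δ '' mipFeasible nrm D ρ ε η M) (robustObj nrm D ρ δ ε wb) := by
  constructor
  · rintro _ ⟨z, hz, rfl⟩
    exact (hmin (classifier_mem_robustFeasible hnrm hD hρ hδ hz)).trans
      (robustObj_le_mipObj hnrm hD hρ hδ hz)
  · intro v hv
    exact (isGLB_mipObj_mipFiber hnrm hD hρ hδ hε hM hF).2
      fun _ ⟨z, hz, he⟩ => hv ⟨z, hz.1, he⟩

end Equivalence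

/-! ### Second-order cone representability -/

section Cone

variable {V W : Type*} [AddCommGroup V] [Module ℝ V] [AddCommGroup W] [Module ℝ W]

/-- A cone system is an intersection of a finite set of cone constraints. -/
theorem isConeSystem_iff_sInter {S : Set V} :
    IsConeSystem S ↔ ∃ 𝒞 : Set (Set V), 𝒞.Finite ∧ (∀ C ∈ 𝒞, IsConeConstraint C) ∧ S = ⋂₀ 𝒞 := by
  constructor
  · rintro ⟨k, C, hC, rfl⟩
    exact ⟨range C, finite_range C, by rintro _ ⟨j, rfl⟩; exact hC j, (sInter_range C).symm⟩
  · rintro ⟨𝒞, hfin, hC, rfl⟩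
    obtain ⟨n, f, -, rfl⟩ := hfin.fin_param
    exact ⟨n, f, fun j => hC _ ⟨j, rfl⟩, sInter_range f⟩

theorem IsConeConstraint.isConeSystem {S : Set V} (h : IsConeConstraint S) : IsConeSystem S :=
  isConeSystem_iff_sInter.2 ⟨{S}, finite_singleton S, by simpa using h, by simp⟩

theorem IsConeSystem.forall {κ : Sort*} [Finite κ] {P : κ → V → Prop}
    (h : ∀ k, IsConeSystem {z | P k z}) : IsConeSystem {z | ∀ k, P k z} := by
  simp only [isConeSystem_iff_sInter] at h ⊢
  choose 𝒞 hfin hC he using h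
  refine ⟨⋃ k, 𝒞 k, finite_iUnion hfin, fun C hmem => ?_, ?_⟩
  · obtain ⟨k, hk⟩ := mem_iUnion.1 hmem
    exact hC k C hk
  · rw [sInter_iUnion, ofPred_forall]
    exact iInter_congr he

theorem IsConeSystem.and {P Q : V → Prop} (hP : IsConeSystem {z | P z})
    (hQ : IsConeSystem {z | Q z}) : IsConeSystem {z | P z ∧ Q z} := by
  rw [isConeSystem_iff_sInter] at *
  obtain ⟨𝒞, h1, h2, h3⟩ := hP
  obtain ⟨𝒟, h4, h5, h6⟩ := hQ
  refine ⟨𝒞 ∪ 𝒟, h1.union h4, fun C hC => hC.elim (h2 C) (h5 C), ?_⟩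
  rw [sInter_union, ← h3, ← h6]
  rfl

theorem IsConeSystem.preimage {S : Set W} (h : IsConeSystem S) (g : V →ᵃ[ℝ] W) :
    IsConeSystem (g ⁻¹' S) := by
  obtain ⟨k, C, hC, rfl⟩ := h
  refine ⟨k, fun j => g ⁻¹' C j, fun j => ?_, preimage_iInter⟩
  obtain ⟨m, F, l, h⟩ := hC j
  exact ⟨m, F.comp g, l.comp g, congrArg (g ⁻¹' ·) h⟩

/-- The real-valued function `f` is affine. -/
def IsAffine (f : V → ℝ) : Prop := ∃ l : V →ᵃ[ℝ] ℝ, ∀ z, f z = l z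

theorem IsAffine.const (c : ℝ) : IsAffine fun _ : V => c :=
  ⟨AffineMap.const ℝ V c, fun _ => rfl⟩

theorem IsAffine.linear (l : V →ₗ[ℝ] ℝ) : IsAffine l := ⟨l.toAffineMap, fun _ => rfl⟩

theorem IsAffine.coord {ι : Type*} (i : ι) : IsAffine fun z : ι → ℝ => z i :=
  IsAffine.linear (LinearMap.proj i : (ι → ℝ) →ₗ[ℝ] ℝ)

theorem IsAffine.add {f g : V → ℝ} (hf : IsAffine f) (hg : IsAffine g) :
    IsAffine fun z => f z + g z := by
  obtain ⟨l, hl⟩ := hf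
  obtain ⟨m, hm⟩ := hg
  exact ⟨l + m, fun z => by simp [hl, hm]⟩

theorem IsAffine.const_mul (c : ℝ) {f : V → ℝ} (hf : IsAffine f) : IsAffine fun z => c * f z := by
  obtain ⟨l, hl⟩ := hf
  exact ⟨c • l, fun z => by simp [hl]⟩

theorem IsAffine.neg {f : V → ℝ} (hf : IsAffine f) : IsAffine fun z => -f z := by
  simpa using hf.const_mul (-1)

theorem IsAffine.sub {f g : V → ℝ} (hf : IsAffine f) (hg : IsAffine g) :
    IsAffine fun z => f z - g z := by
  simpa only [sub_eq_add_neg] using hf.add hg.neg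

theorem IsAffine.sum {κ : Type*} (s : Finset κ) {f : κ → V → ℝ} (hf : ∀ k, IsAffine (f k)) :
    IsAffine fun z => ∑ k ∈ s, f k z := by
  choose l hl using hf
  refine ⟨∑ k ∈ s, l k, fun z => ?_⟩
  induction s using Finset.cons_induction with
  | empty => simp
  | cons a s ha ih => simp only [Finset.sum_cons, AffineMap.coe_add, Pi.add_apply, ← ih, hl]

theorem isConeSystem_le {f g : V → ℝ} (hf : IsAffine f) (hg : IsAffine g) :
    IsConeSystem {z | f z ≤ g z} := by
  obtain ⟨l, hl⟩ := hg.sub hf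
  refine IsConeConstraint.isConeSystem ⟨0, AffineMap.const ℝ V 0, l, ?_⟩
  ext z
  simp [← hl]

theorem isConeSystem_sqrt_le {f g h : V → ℝ} (hf : IsAffine f) (hg : IsAffine g)
    (hh : IsAffine h) : IsConeSystem {z | Real.sqrt (f z ^ 2 + g z ^ 2) ≤ h z} := by
  obtain ⟨l, hl⟩ := hf
  obtain ⟨m, hm⟩ := hg
  obtain ⟨n, hn⟩ := hh
  refine IsConeConstraint.isConeSystem ⟨2,
    (WithLp.linearEquiv 2 ℝ (Fin 2 → ℝ)).symm.toLinearMap.toAffineMap.comp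
      (AffineMap.pi ![l, m]), n, ?_⟩
  ext z
  simp [EuclideanSpace.norm_eq, Fin.sum_univ_two, hl, hm, hn]

end Cone

section Program

variable {d N : ℕ} {nrm : Seminorm ℝ (Fin d → ℝ)}

instance : Finite (Var d N) := by
  let f : Fin d ⊕ Fin 3 ⊕ (Attr × Label) ⊕ (Attr × Label) ⊕ Fin N ⊕ (Attr × Fin N) → Var d N :=
    Sum.elim .w (Sum.elim ![.b, .zeta, .theta] (Sum.elim (fun k => .r k.1 k.2)
      (Sum.elim (fun k => .s k.1 k.2) (Sum.elim .t fun k => .lam k.1 k.2))))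
  refine Finite.of_surjective f fun v => ?_
  cases v with
  | w j => exact ⟨.inl j, rfl⟩
  | b => exact ⟨.inr (.inl 0), rfl⟩
  | zeta => exact ⟨.inr (.inl 1), rfl⟩
  | theta => exact ⟨.inr (.inl 2), rfl⟩
  | r a y => exact ⟨.inr (.inr (.inl (a, y))), rfl⟩
  | s a y => exact ⟨.inr (.inr (.inr (.inl (a, y)))), rfl⟩
  | t i => exact ⟨.inr (.inr (.inr (.inr (.inl i)))), rfl⟩
  | lam a i => exact ⟨.inr (.inr (.inr (.inr (.inr (a, i))))), rfl⟩

/-- A constraint with a nonnegative multiple of the dual norm is the preimage of the epigraph of the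
dual norm under an affine map, or an affine inequality if the multiple is zero. -/
theorem isConeSystem_add_mul_dualNorm_le
    (hcone : IsConeSystem {q : (Fin d → ℝ) × ℝ | dualNorm nrm q.1 ≤ q.2})
    {f g : (Var d N → ℝ) → ℝ} (hf : IsAffine f) (hg : IsAffine g) {ρ : ℝ} (hρ : 0 ≤ ρ) :
    IsConeSystem {z | f z + ρ * dualNorm nrm (classifier z).1 ≤ g z} := by
  rcases hρ.eq_or_lt with rfl | hpos
  · simpa using isConeSystem_le hf hg
  · obtain ⟨l, hl⟩ := (hg.sub hf).const_mul ρ⁻¹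
    convert hcone.preimage ((LinearMap.funLeft ℝ ℝ (Var.w (d := d) (N := N))).toAffineMap.prod l)
      using 1
    ext z
    have : (LinearMap.funLeft ℝ ℝ (Var.w (d := d) (N := N))) z = (classifier z).1 := rfl
    simp only [mem_ofPred_eq, mem_preimage, AffineMap.prod_apply, LinearMap.coe_toAffineMap, this,
      ← hl]
    rw [inv_mul_eq_div, le_div_iff₀ hpos, mul_comm, le_sub_iff_add_le, add_comm]

theorem isAffine_classifier_fst_dotProduct (x : Fin d → ℝ) :
    IsAffine fun z : Var d N → ℝ => (classifier z).1 ⬝ᵥ x := by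
  have h := IsAffine.sum (V := Var d N → ℝ) (Finset.univ : Finset (Fin d))
    (f := fun j z => x j * z (.w j)) fun j => (IsAffine.coord (Var.w j)).const_mul (x j)
  simpa only [dotProduct, classifier, mul_comm] using h

theorem isAffine_classifier_snd : IsAffine fun z : Var d N → ℝ => (classifier z).2 :=
  IsAffine.coord Var.b

theorem exists_linearMap_mipObj_eq (D : Samples d N) (δ : ℝ) :
    ∃ l : (Var d N → ℝ) →ₗ[ℝ] ℝ, ∀ z, mipObj D δ z = l z := by
  let π : Var d N → (Var d N → ℝ) →ₗ[ℝ] ℝ := LinearMap.proj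
  refine ⟨δ • π .zeta - π .theta - (2 : ℝ) • (∑ a, ∑ y, D.phat a y • π (.r a y)) +
    (2 * ∑ a, ∑ y, D.phat a y) • π .zeta, fun z => ?_⟩
  simp only [mipObj, π, LinearMap.add_apply, LinearMap.sub_apply, LinearMap.smul_apply,
    LinearMap.sum_apply, LinearMap.proj_apply, smul_eq_mul]
  ring

theorem isMixedBinarySOCP_mip {D : Samples d N} {ρ : Attr → Label → ℝ} (hρ : ∀ a y, 0 ≤ ρ a y)
    (hcone : IsConeSystem {q : (Fin d → ℝ) × ℝ | dualNorm nrm q.1 ≤ q.2}) (δ ε η M : ℝ) :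
    IsMixedBinarySOCP (mipObj (d := d) (N := N) D δ) (mipFeasible nrm D ρ ε η M) := by
  have hx := isAffine_classifier_fst_dotProduct (d := d) (N := N)
  have hb := isAffine_classifier_snd (d := d) (N := N)
  have hv := fun v : Var d N => IsAffine.coord (ι := Var d N) v
  have hc := fun c : ℝ => IsAffine.const (V := Var d N → ℝ) c
  have hsθ : ∀ a y, IsAffine fun z : Var d N → ℝ => z (.s a y) + z .theta :=
    fun a y => (hv _).add (hv _)
  have h1 : IsConeSystem {z : Var d N → ℝ | 0 ≤ z .zeta} := isConeSystem_le (hc 0) (hv _)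
  have h2 : IsConeSystem {z : Var d N → ℝ | ∀ a y, z (.s a y) + z .theta ≤ z .zeta} :=
    .forall fun a => .forall fun y => isConeSystem_le (hsθ a y) (hv _)
  have h3 : IsConeSystem {z : Var d N → ℝ | ∀ a y,
      Real.sqrt (4 * z (.r a y) ^ 2 + (z (.s a y) + z .theta) ^ 2)
        ≤ 2 * z .zeta - z (.s a y) - z .theta} := by
    refine .forall fun a => .forall fun y => ?_
    have h := isConeSystem_sqrt_le ((hv (.r a y)).const_mul 2) (hsθ a y)
      ((((hv .zeta).const_mul 2).sub (hv (.s a y))).sub (hv .theta))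
    have h4 : ∀ z : Var d N → ℝ, (2 * z (.r a y)) ^ 2 = 4 * z (.r a y) ^ 2 := fun z => by ring
    simpa only [h4] using h
  have h4 : IsConeSystem {z : Var d N → ℝ | ∀ a y,
      1 / ((D.group a y).card : ℝ) * ∑ i ∈ D.group a y, z (.t i) ≤ z (.s a y)} :=
    .forall fun a => .forall fun y =>
      isConeSystem_le ((IsAffine.sum _ fun i => hv (.t i)).const_mul _) (hv _)
  have h5 : IsConeSystem {z : Var d N → ℝ | ∀ i,
      -sgn (D.y i) * ((classifier z).1 ⬝ᵥ D.x i + (classifier z).2)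
        + ρ (D.a i) (D.y i) * dualNorm nrm (classifier z).1 ≤ M * z (.t i) - ε} :=
    .forall fun i => isConeSystem_add_mul_dualNorm_le hcone (((hx (D.x i)).add hb).const_mul _)
      (((hv _).const_mul M).sub (hc ε)) (hρ _ _)
  have h6 : IsConeSystem {z : Var d N → ℝ | ∀ a a' : Attr, a ≠ a' →
      1 / ((D.group a 1).card : ℝ) * ∑ i ∈ D.group a 1, z (.lam a i)
        + 1 / ((D.group a' 1).card : ℝ) * ∑ i ∈ D.group a' 1, z (.lam a i) - 1 ≤ η ∧
      (∀ i ∈ D.group a 1, (classifier z).1 ⬝ᵥ D.x i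
        + ρ a 1 * dualNorm nrm (classifier z).1 + (classifier z).2 + ε ≤ M * z (.lam a i)) ∧
      (∀ i ∈ D.group a' 1, -((classifier z).1 ⬝ᵥ D.x i)
        + ρ a' 1 * dualNorm nrm (classifier z).1 - (classifier z).2 ≤ M * z (.lam a i))} := by
    refine .forall fun a => .forall fun a' => .forall fun _ => .and ?_ (.and ?_ ?_)
    · exact isConeSystem_le ((((IsAffine.sum _ fun i => hv (.lam a i)).const_mul _).add
        ((IsAffine.sum _ fun i => hv (.lam a i)).const_mul _)).sub (hc 1)) (hc η)
    · refine .forall fun i => .forall fun _ => ?_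
      have h := isConeSystem_add_mul_dualNorm_le hcone (((hx (D.x i)).add hb).add (hc ε))
        ((hv (.lam a i)).const_mul M) (hρ a 1)
      convert h using 4
      ring
    · refine .forall fun i => .forall fun _ => ?_
      have h := isConeSystem_add_mul_dualNorm_le hcone ((hx (D.x i)).neg.sub hb)
        ((hv (.lam a i)).const_mul M) (hρ a' 1)
      convert h using 4
      ring
  refine ⟨inferInstance, exists_linearMap_mipObj_eq D δ, _,
    range Var.t ∪ range fun k : Attr × Fin N => Var.lam k.1 k.2,
    h1.and (h2.and (h3.and (h4.and (h5.and h6)))), ?_⟩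
  ext z
  have hB : (∀ v ∈ range Var.t ∪ range (fun k : Attr × Fin N => Var.lam (d := d) k.1 k.2),
      z v = 0 ∨ z v = 1) ↔
      (∀ i, z (.t i) = 0 ∨ z (.t i) = 1) ∧ ∀ a i, z (.lam a i) = 0 ∨ z (.lam a i) = 1 := by
    constructor
    · exact fun h => ⟨fun i => h _ (.inl ⟨i, rfl⟩), fun a i => h _ (.inr ⟨(a, i), rfl⟩)⟩
    · rintro ⟨ht, hl⟩ _ (⟨i, rfl⟩ | ⟨k, rfl⟩)
      · exact ht i
      · exact hl _ _
  change _ ↔ _ ∧ _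
  rw [hB]
  constructor
  · rintro ⟨k1, kt, kl, k2, k3, k4, k5, k6⟩
    exact ⟨⟨k1, k2, k3, k4, k5, k6⟩, kt, kl⟩
  · rintro ⟨⟨k1, k2, k3, k4, k5, k6⟩, kt, kl⟩
    exact ⟨k1, kt, kl, k2, k3, k4, k5, k6⟩

end Program

end DRFC

theorem mainTheorem5 {d N : ℕ} (nrm : Seminorm ℝ (Fin d → ℝ))
    (hnrm : ∀ x, nrm x = 0 → x = 0)
    (D : DRFC.Samples d N) (hD : ∀ a y, (D.group a y).Nonempty)
    (ρ : DRFC.Attr → DRFC.Label → ℝ) (hρ : ∀ a y, 0 ≤ ρ a y)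
    (δ ε η : ℝ) (hδ : 0 ≤ δ) (hε : 0 < ε) (hη : 0 ≤ η) :
    -- for every `M`, feasible points of the program give feasible classifiers
    -- whose worst-case objective is at most the objective of the program
    (∀ (M : ℝ), ∀ z ∈ DRFC.mipFeasible nrm D ρ ε η M,
      DRFC.classifier z ∈ DRFC.robustFeasible nrm D ρ δ ε η ∧
      DRFC.robustObj nrm D ρ δ ε (DRFC.classifier z) ≤ DRFC.mipObj D δ z) ∧
    -- for all classifiers in a bounded set and all large `M`: same feasibility, and the worst-case
    -- objective is the partial infimum over the remaining variables
    (∀ R : ℝ, ∃ M₀ : ℝ, ∀ M ≥ M₀, ∀ (w : Fin d → ℝ) (b : ℝ), (∀ j, |w j| ≤ R) → |b| ≤ R →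
      ((w, b) ∈ DRFC.robustFeasible nrm D ρ δ ε η ↔
        (DRFC.mipFiber nrm D ρ ε η M (w, b)).Nonempty) ∧
      ((w, b) ∈ DRFC.robustFeasible nrm D ρ δ ε η →
        IsGLB (DRFC.mipObj D δ '' DRFC.mipFiber nrm D ρ ε η M (w, b))
          (DRFC.robustObj nrm D ρ δ ε (w, b)) ∧
        (0 < δ → IsLeast (DRFC.mipObj D δ '' DRFC.mipFiber nrm D ρ ε η M (w, b))
          (DRFC.robustObj nrm D ρ δ ε (w, b))))) ∧
    -- for all large `M` the two (unrestricted) problems have the same optimal value, and the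
    -- classifiers in optimal points of the program are optimal for the robust problem
    (∃ M₀ v : ℝ,
      IsLeast (DRFC.robustObj nrm D ρ δ ε '' DRFC.robustFeasible nrm D ρ δ ε η) v ∧
      ∀ M ≥ M₀,
        IsGLB (DRFC.mipObj D δ '' DRFC.mipFeasible nrm D ρ ε η M) v ∧
        (0 < δ → IsLeast (DRFC.mipObj D δ '' DRFC.mipFeasible nrm D ρ ε η M) v) ∧
        ∀ z ∈ DRFC.mipFeasible nrm D ρ ε η M,
          IsMinOn (DRFC.mipObj D δ) (DRFC.mipFeasible nrm D ρ ε η M) z →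
          DRFC.classifier z ∈ DRFC.robustFeasible nrm D ρ δ ε η ∧
          IsMinOn (DRFC.robustObj nrm D ρ δ ε) (DRFC.robustFeasible nrm D ρ δ ε η)
            (DRFC.classifier z)) ∧
    -- every optimal classifier is part of an optimal point of the program once `M` is large
    (0 < δ → ∀ wb ∈ DRFC.robustFeasible nrm D ρ δ ε η,
      IsMinOn (DRFC.robustObj nrm D ρ δ ε) (DRFC.robustFeasible nrm D ρ δ ε η) wb →
      ∃ M₀ : ℝ, ∀ M ≥ M₀, ∃ z ∈ DRFC.mipFeasible nrm D ρ ε η M, DRFC.classifier z = wb ∧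
        IsMinOn (DRFC.mipObj D δ) (DRFC.mipFeasible nrm D ρ ε η M) z) ∧
    -- the program is a mixed-binary second-order cone program as soon as
    -- the epigraph of the dual norm is described by second-order cone constraints
    (DRFC.IsConeSystem {q : (Fin d → ℝ) × ℝ | DRFC.dualNorm nrm q.1 ≤ q.2} →
      ∀ M : ℝ, DRFC.IsMixedBinarySOCP (DRFC.mipObj (d := d) (N := N) D δ)
        (DRFC.mipFeasible nrm D ρ ε η M)) := by
  have h1 : ∀ (M : ℝ), ∀ z ∈ DRFC.mipFeasible nrm D ρ ε η M,
      DRFC.classifier z ∈ DRFC.robustFeasible nrm D ρ δ ε η ∧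
      DRFC.robustObj nrm D ρ δ ε (DRFC.classifier z) ≤ DRFC.mipObj D δ z := fun M z hz =>
    ⟨DRFC.classifier_mem_robustFeasible hnrm hD hρ hδ hz,
      DRFC.robustObj_le_mipObj hnrm hD hρ hδ hz⟩
  have hbig := DRFC.exists_isBigM (D := D) hnrm hρ ε
  have hattain : ∀ {M : ℝ} {wb : (Fin d → ℝ) × ℝ}, 0 < δ → DRFC.IsBigM nrm D ρ ε wb.1 wb.2 M →
      wb ∈ DRFC.robustFeasible nrm D ρ δ ε η →
      ∃ z ∈ DRFC.mipFiber nrm D ρ ε η M wb,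
        DRFC.mipObj D δ z = DRFC.robustObj nrm D ρ δ ε wb :=
    fun hpos hM hF => DRFC.exists_mem_mipFiber_eq hnrm hD hρ hpos hε.le hM hF
  refine ⟨h1, fun R => ?_, ?_, fun hpos wb hwb hmin => ?_, fun hcone M =>
    DRFC.isMixedBinarySOCP_mip hρ hcone δ ε η M⟩
  · obtain ⟨M₀, hM₀⟩ := hbig R
    refine ⟨M₀, fun M hM w b hw hb => ?_⟩
    have hM' := hM₀ M hM w b hw hb
    refine ⟨⟨fun hF => ?_, ?_⟩, fun hF => ?_⟩
    · obtain ⟨z, hz, -⟩ :=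
        DRFC.exists_mem_mipFiber_le_add hnrm hD hρ hδ hε.le hM' hF zero_lt_one
      exact ⟨z, hz⟩
    · rintro ⟨z, hz, hcl⟩
      exact hcl ▸ (h1 M z hz).1
    · have hglb := DRFC.isGLB_mipObj_mipFiber hnrm hD hρ hδ hε.le hM' hF
      refine ⟨hglb, fun hpos => ⟨?_, hglb.1⟩⟩
      obtain ⟨z, hz, he⟩ := hattain hpos hM' hF
      exact ⟨z, hz, he⟩
  · obtain ⟨wb, hwb, hmin⟩ := DRFC.exists_isMinOn_robustObj (ε := ε) hnrm hD hρ hδ hη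
    obtain ⟨R, hw, hb⟩ := DRFC.exists_abs_le wb
    obtain ⟨M₀, hM₀⟩ := hbig R
    refine ⟨M₀, DRFC.robustObj nrm D ρ δ ε wb, ⟨⟨wb, hwb, rfl⟩, ?_⟩, fun M hM => ?_⟩
    · rintro _ ⟨wb', h', rfl⟩
      exact hmin h'
    · have hM' := hM₀ M hM wb.1 wb.2 hw hb
      have hglb := DRFC.isGLB_mipObj_mipFeasible hnrm hD hρ hδ hε.le hM' hwb hmin
      refine ⟨hglb, fun hpos => ⟨?_, hglb.1⟩, fun z hz hzmin => ⟨(h1 M z hz).1, fun wb' h' => ?_⟩⟩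
      · obtain ⟨z, hz, he⟩ := hattain hpos hM' hwb
        exact ⟨z, hz.1, he⟩
      · have hz_le : DRFC.mipObj D δ z ≤ DRFC.robustObj nrm D ρ δ ε wb := hglb.2 (by
          rintro _ ⟨z', hz', rfl⟩
          exact hzmin hz')
        exact ((h1 M z hz).2.trans hz_le).trans (hmin h')
  · obtain ⟨R, hw, hb⟩ := DRFC.exists_abs_le wb
    obtain ⟨M₀, hM₀⟩ := hbig R
    refine ⟨M₀, fun M hM => ?_⟩
    obtain ⟨z, hz, he⟩ := hattain hpos (hM₀ M hM wb.1 wb.2 hw hb) hwb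
    refine ⟨z, hz.1, hz.2, fun z' hz' => ?_⟩
    change DRFC.mipObj D δ z ≤ DRFC.mipObj D δ z'
    rw [he]
    exact (hmin (h1 M z' hz').1).trans (h1 M z' hz').2
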